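/- **Theorem (Cohen–Gabber).** Let $p$ be a prime number, and let $A$ be a reduced complete noetherian local ring of equal characteristic $p>0$, with residue field $k$. Suppose that $A$ is equidimensional of dimension $d$, i.e. that $\dim A/\mathfrak{p}=d$ for every minimal prime ideal $\mathfrak{p}$ of $A$. Then there is a subring $A_0$ of $A$, isomorphic as a ring to the formal power series ring $k[[t_1,\dots,t_d]]$, such that $A$ is finite and torsion-free as an $A_0$-module and generically étale over $A_0$. The last condition means that there is $f\in A_0$ such that $D(f)$ is dense in $\operatorname{Spec}A_0$, its inverse image $\operatorname{Spec}A_f$ is dense in $\operatorname{Spec}A$, and $A_f$ is étale over $A_0$ (equivalently, over $(A_0)_f$). Moreover, the inclusion $A_0\to A$ is a local homomorphism of local rings and induces an isomorphism on residue fields. -/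

import Mathlib

/-- A ring is equidimensional of dimension `d` if all the irreducible components of its spectrum,
i.e. the spectra of its quotients by its minimal primes, have Krull dimension `d`. -/
def IsEquidimensionalOfDim (R : Type*) [CommRing R] (d : ℕ) : Prop :=
  ∀ P ∈ minimalPrimes R, ringKrullDim (R ⧸ P) = d

/-- `S` is generically étale over the (noetherian) ring `R`, on the source and on the target: for
some `f : R` such that `D(f)` is dense in `Spec R` and its inverse image is dense in `Spec S`,
this inverse image `Spec S_f` is étale over `Spec R` (equivalently, over its open subscheme
`D(f)`). When `R` is noetherian, each dense open subset of `Spec R` contains such a `D(f)`, so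
that nothing is lost by taking a principal open subset. -/
def IsGenericallyEtale (R S : Type*) [CommRing R] [CommRing S] [Algebra R S] : Prop :=
  ∃ f : R, Dense (PrimeSpectrum.basicOpen f : Set (PrimeSpectrum R)) ∧
    Dense (PrimeSpectrum.basicOpen (algebraMap R S f) : Set (PrimeSpectrum S)) ∧
    Algebra.Etale R (Localization.Away (algebraMap R S f))

/-!
The theorem asks for a finite injective homomorphism `ψ : k⟦t₁, …, t_d⟧ → A`, inducing the identity
on residue fields, such that the total ring of fractions of `A` is étale over that of the power
series ring, i.e. such that all derivations of the residue fields of `A` at its minimal primes over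
`k⟦t₁, …, t_d⟧` vanish (`Derivation.IsGenericAt`).

*Existence of a finite homomorphism.* A field `k` of characteristic `p` is formally smooth over its
prime field (`formallySmooth_zmod`), so that `A` has a coefficient field. Together with a system of
parameters this gives a finite homomorphism `ψ` (`exists_finite_ringHom_of_ringKrullDim_le`). As `A`
is equidimensional of dimension `d`, each finite homomorphism from `k⟦t₁, …, t_d⟧` to `A` is
injective modulo each minimal prime (`comap_eq_bot_of_ringKrullDim_eq`). In particular it can be
perturbed freely, as long as it remains finite.

*Perturbation.* Let `D` be a derivation of `k⟦t₁, …, t_d⟧` given by a derivation of `k` and by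
logarithmic derivations in the variables, and let `w` be an element of the ideal generated by the
`ψ(t_j)`. Again by formal smoothness, there is a homomorphism `ψ'` which is congruent to
`ψ + w ψ ∘ D` modulo `w ^ 2` (`exists_perturbation`). The elements killed by all these derivations
`D` are the `p`-th powers (`exists_pow_eq_of_coeffDerivation_eq_zero`).

*One generator.* Suppose first that `A` is replaced by a ring `B` generated by a single element `z`
over the image of `ψ`, and let `Q` be a prime at which `z` is inseparable over this image. Then `z`
is a root modulo `Q` of a polynomial `f` with `f' = 0`, for which some derivation `D` as above
satisfies `f^D(z) ≠ 0` modulo `Q`, where `f^D` arises from `f` by applying `D` to the coefficients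
(`exists_derivEval_notMem_of_not_isSepAt`). Take `w = z ^ N` with `N` large and congruent to `1`
modulo `p`. If a generic derivation `δ` at `Q` vanishes on `ψ'`, applying it to `f(z) ∈ Q` gives
`z ^ (N - 1) (f^D(z) + z ^ N c) δ z = 0` for some `c`
(`Derivation.exists_map_eval₂_eq`), hence `δ z = 0`: the element `z` is separable over the image of
`ψ'`. The same computation shows that `z` remains separable at the primes where it already was.
This proves `exists_isSepAt`.

*All generators.* In general this is applied in turn to the subrings `ψ(k⟦t₁, …, t_d⟧)[z]`, for `z`
in a finite set of generators of `A` (`exists_perturbation_of_subset_maximalIdeal`). A derivation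
which kills the image of the last homomorphism kills the images of all the preceding ones and all
generators. So the local rings of `A` at the minimal primes are unramified over the power series
ring, hence étale, being fields, and étaleness spreads out to an open set
(`isGenericallyEtale_of_formallyUnramified`).
-/

/-! ### Sections of square-zero extensions of a field of characteristic `p` -/

section SquareZero

open Polynomial

variable {E k : Type*} [CommRing E] [Field k] {p : ℕ} [Fact p.Prime] [CharP k p]

/-- The image in `k` of a subring of `E` containing all `p`-th powers is a subfield: the inverse
of `y` is `y ^ (p - 1) * (y⁻¹) ^ p`. -/
def subfieldOfPowMem (π : E →+* k) (hπ : Function.Surjective π) (T : Subring E)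
    (hT : ∀ e : E, e ^ p ∈ T) : Subfield k where
  __ := T.map π
  inv_mem' := by
    rintro _ ⟨t, ht, rfl⟩
    obtain ⟨e, he⟩ := hπ (π t)⁻¹
    refine ⟨t ^ (p - 1) * e ^ p, T.mul_mem (T.pow_mem ht _) (hT e), ?_⟩
    have hp : p = p - 1 + 1 := by have := (Fact.out : p.Prime).pos; omega
    by_cases h0 : π t = 0
    · rw [map_mul, map_pow, map_pow, he, h0, inv_zero, zero_pow (Fact.out : p.Prime).ne_zero,
        mul_zero]
    · rw [map_mul, map_pow, map_pow, he]
      nth_rw 2 [hp]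
      rw [pow_succ, ← mul_assoc, ← mul_pow, mul_inv_cancel₀ h0, one_pow, one_mul]

/-- Let `T` be a subring of `E` which contains all `p`-th powers and is mapped injectively to `k`.
If the image of `u` is not in the image of `T`, then its minimal polynomial over this image is
`X ^ p - u ^ p`, so that `T[u]` is still mapped injectively to `k`. -/
lemma eval₂_eq_zero_of_map_eq_zero (π : E →+* k) (hπ : Function.Surjective π) (T : Subring E)
    (hT : ∀ e : E, e ^ p ∈ T) (hinj : ∀ x ∈ T, π x = 0 → x = 0) (u : E)
    (hu : ∀ t ∈ T, π t ≠ π u) (q : T[X]) (hq : π (q.eval₂ T.subtype u) = 0) :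
    q.eval₂ T.subtype u = 0 := by
  have hp : p.Prime := Fact.out
  let M : Subfield k := subfieldOfPowMem π hπ T hT
  let φ : T →+* M := (π.comp T.subtype).codRestrict M fun t => ⟨t, t.2, rfl⟩
  have hφ : Function.Injective φ := by
    rw [injective_iff_map_eq_zero]
    intro t ht
    exact Subtype.ext (hinj t t.2 (congrArg Subtype.val ht))
  let a : T := ⟨u ^ p, hT u⟩
  let g : T[X] := X ^ p - C a
  have hg : g.Monic := monic_X_pow_sub_C a hp.ne_zero
  have hgu : g.eval₂ T.subtype u = 0 := by simp [g, a]
  have hgM : g.map φ = X ^ p - C (φ a) := by simp [g]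
  have hirr : Irreducible (g.map φ) := by
    rw [hgM]
    refine X_pow_sub_C_irreducible_of_prime hp fun b hb => ?_
    obtain ⟨t, ht, htb⟩ := b.2
    refine hu t ht ?_
    apply frobenius_inj k p
    have := congrArg Subtype.val hb
    simp only [frobenius_def]
    have h2 : π t = (b : k) := htb
    rw [h2]
    rw [← map_pow]
    exact this
  have hroot : aeval (π u) (g.map φ) = 0 := by
    rw [aeval_def, eval₂_map]
    have : (algebraMap M k).comp φ = π.comp T.subtype := rfl
    rw [this, ← hom_eval₂, hgu, map_zero]
  have hmin : g.map φ = minpoly M (π u) :=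
    minpoly.eq_of_irreducible_of_monic hirr hroot (hg.map φ)
  have : Nontrivial T := φ.domain_nontrivial
  have hqr : q.eval₂ T.subtype u = (q %ₘ g).eval₂ T.subtype u := by
    conv_lhs => rw [← modByMonic_add_div q g]
    rw [eval₂_add, eval₂_mul, hgu, zero_mul, add_zero]
  have hr : q %ₘ g = 0 := by
    apply Polynomial.map_injective φ hφ
    rw [Polynomial.map_zero]
    by_contra hne
    have h1 : aeval (π u) ((q %ₘ g).map φ) = 0 := by
      rw [aeval_def, eval₂_map]
      have : (algebraMap M k).comp φ = π.comp T.subtype := rfl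
      rw [this, ← hom_eval₂, ← hqr, hq]
    have h2 := minpoly.degree_le_of_ne_zero M (π u) hne h1
    rw [← hmin, degree_map_eq_of_injective hφ, degree_map_eq_of_injective hφ] at h2
    exact absurd (degree_modByMonic_lt q hg) (not_lt.mpr h2)
  rw [hqr, hr, eval₂_zero]

/-- Each subring of `E` which contains the `p`-th powers and is mapped injectively to `k` extends to
one which is mapped bijectively to `k`: by Zorn's lemma there is a maximal extension, to which no
element can be adjoined. -/
lemma exists_subring_bijective (π : E →+* k) (hπ : Function.Surjective π) (T : Subring E)
    (hT : ∀ e : E, e ^ p ∈ T) (hinj : ∀ x ∈ T, π x = 0 → x = 0) :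
    ∃ T' : Subring E, T ≤ T' ∧ Function.Bijective (π.comp T'.subtype) := by
  obtain ⟨T', hTT', hmax⟩ := zorn_le_nonempty₀
    {S : Subring E | (∀ e : E, e ^ p ∈ S) ∧ ∀ x ∈ S, π x = 0 → x = 0} (by
      intro c hc hchain S hS
      refine ⟨sSup c, ⟨fun e => ?_, fun x hx => ?_⟩, fun S hS => le_sSup hS⟩
      · exact (le_sSup hS : S ≤ sSup c) ((hc hS).1 e)
      · obtain ⟨S', hS', hx'⟩ :=
          (Subring.mem_sSup_of_directedOn ⟨S, hS⟩ hchain.directedOn).mp hx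
        exact (hc hS').2 x hx') T ⟨hT, hinj⟩
  refine ⟨T', hTT', ?_, ?_⟩
  · rw [injective_iff_map_eq_zero]
    exact fun t ht => Subtype.ext (hmax.prop.2 t t.2 ht)
  · intro y
    by_contra! hy
    obtain ⟨u, rfl⟩ := hπ y
    let S : Subring E := (eval₂RingHom T'.subtype u).range
    have hle : T' ≤ S := fun t ht => ⟨C ⟨t, ht⟩, by simp⟩
    have hS : S ≤ T' := by
      refine hmax.2 ⟨fun e => hle (hmax.prop.1 e), ?_⟩ hle
      rintro _ ⟨q, rfl⟩ hq
      exact eval₂_eq_zero_of_map_eq_zero π hπ T' hmax.prop.1 hmax.prop.2 u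
        (fun t ht => hy ⟨t, ht⟩) q hq
    exact hy ⟨u, hS ⟨X, by simp⟩⟩ rfl

end SquareZero

lemma eq_zero_of_mem_frobenius_range {E k : Type*} [CommRing E] [Field k] {p : ℕ} [Fact p.Prime]
    [CharP E p] (π : E →+* k) (hsq : ∀ x, π x = 0 → x ^ 2 = 0) :
    ∀ x ∈ (frobenius E p).range, π x = 0 → x = 0 := by
  rintro _ ⟨e, rfl⟩ h
  have hp : p.Prime := Fact.out
  rw [frobenius_def, map_pow] at h
  rw [frobenius_def]
  exact pow_eq_zero_of_le hp.two_le (hsq e (eq_zero_of_pow_eq_zero h))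

/-- A surjection of `ZMod p`-algebras onto a field whose kernel consists of elements of square
zero has a section. -/
lemma exists_section_of_sq_eq_zero (p : ℕ) [Fact p.Prime] {k E : Type*} [Field k]
    [Algebra (ZMod p) k] [CommRing E] [Algebra (ZMod p) E] (f : E →ₐ[ZMod p] k)
    (hf : Function.Surjective f) (hsq : ∀ x, f x = 0 → x ^ 2 = 0) :
    ∃ g : k →ₐ[ZMod p] E, f.comp g = AlgHom.id (ZMod p) k := by
  have : CharP k p := charP_of_injective_algebraMap (algebraMap (ZMod p) k).injective p
  have : Nontrivial E := f.toRingHom.domain_nontrivial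
  have : CharP E p := charP_of_injective_algebraMap (algebraMap (ZMod p) E).injective p
  obtain ⟨T, -, hT⟩ := exists_subring_bijective (p := p) f.toRingHom hf
    (frobenius _ p).range (fun e => ⟨e, rfl⟩) (eq_zero_of_mem_frobenius_range _ hsq)
  let e := RingEquiv.ofBijective _ hT
  let g : k →+* E := T.subtype.comp e.symm.toRingHom
  refine ⟨{ g with commutes' := fun r => ?_ }, ?_⟩
  · exact RingHom.congr_fun (Subsingleton.elim (g.comp (algebraMap (ZMod p) k)) (algebraMap _ _)) r
  · ext a
    exact e.apply_symm_apply a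

/-- A field of characteristic `p` is formally smooth over its prime field. -/
lemma formallySmooth_zmod (p : ℕ) [Fact p.Prime] (k : Type*) [Field k] [Algebra (ZMod p) k] :
    Algebra.FormallySmooth (ZMod p) k := by
  let f : MvPolynomial k (ZMod p) →ₐ[ZMod p] k := MvPolynomial.aeval id
  have hf : Function.Surjective f := fun a => ⟨MvPolynomial.X a, by simp [f]⟩
  rw [Algebra.FormallySmooth.iff_split_surjection f hf]
  refine exists_section_of_sq_eq_zero p f.kerSquareLift (fun a => ?_) fun x hx => ?_
  · obtain ⟨b, rfl⟩ := hf a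
    exact ⟨Ideal.Quotient.mk _ b, rfl⟩
  · obtain ⟨x, rfl⟩ := Ideal.Quotient.mk_surjective x
    rw [← map_pow]
    exact Ideal.Quotient.eq_zero_iff_mem.mpr (Ideal.pow_mem_pow hx 2)

/-- In a field of characteristic `p`, an element which is not a `p`-th power is not annihilated by
all derivations. -/
lemma exists_derivation_ne_zero (p : ℕ) [Fact p.Prime] {k : Type*} [Field k] [CharP k p] (c : k)
    (hc : ∀ b : k, b ^ p ≠ c) : ∃ D : Derivation ℤ k k, D c ≠ 0 := by
  let π : TrivSqZeroExt k k →+* k := (TrivSqZeroExt.fstHom k k k).toRingHom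
  have hπ : Function.Surjective π := fun a => ⟨TrivSqZeroExt.inl a, rfl⟩
  have : CharP (TrivSqZeroExt k k) p :=
    charP_of_injective_algebraMap (algebraMap k (TrivSqZeroExt k k)).injective p
  let T := (frobenius (TrivSqZeroExt k k) p).range
  let u : TrivSqZeroExt k k := TrivSqZeroExt.inl c + TrivSqZeroExt.inr 1
  have hT : ∀ x ∈ T, π x = 0 → x = 0 := eq_zero_of_mem_frobenius_range π (by
    intro x hx
    have : x.fst = 0 := hx
    ext <;> simp [pow_two, this])
  -- the subring generated by the `p`-th powers and the lift `c + ε` of `c`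
  let T₁ : Subring (TrivSqZeroExt k k) := (Polynomial.eval₂RingHom T.subtype u).range
  obtain ⟨T', hle, hT'⟩ := exists_subring_bijective (p := p) π hπ T₁
    (fun e => ⟨Polynomial.C ⟨e ^ p, e, rfl⟩, by simp⟩) (by
      rintro _ ⟨q, rfl⟩ hq
      refine eval₂_eq_zero_of_map_eq_zero π hπ T (fun e => ⟨e, rfl⟩) hT u ?_ q hq
      rintro _ ⟨e, rfl⟩ h
      apply hc e.fst
      have h2 : π u = c := by simp [π, u]
      rw [h2, frobenius_def, map_pow] at h
      exact h)
  let e := RingEquiv.ofBijective _ hT'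
  let s : k →+* TrivSqZeroExt k k := T'.subtype.comp e.symm.toRingHom
  have hs : ∀ a, (s a).fst = a := e.apply_symm_apply
  have hsc : s c = u := by
    have hu : u ∈ T' := hle ⟨Polynomial.X, by simp⟩
    have : e ⟨u, hu⟩ = c := by simp [e, π, u]
    rw [← this]
    simp [s]
  let D : Derivation ℤ k k := Derivation.mk'
    ({ toFun := fun a => (s a).snd
       map_zero' := by simp
       map_add' := by simp } : k →+ k).toIntLinearMap (by
      intro a b
      simp [hs, mul_comm])
  refine ⟨D, ?_⟩
  have : D c = (s c).snd := rfl
  rw [this, hsc]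
  simp [u]

/-! ### Power series over a field: evaluation, derivations and `p`-th powers -/

section PowerSeries

open MvPowerSeries

variable {d : ℕ} {k : Type*}

/-- The ideal generated by the variables in a power series ring over a field. -/
noncomputable abbrev varsIdeal (d : ℕ) (k : Type*) [Field k] : Ideal (MvPowerSeries (Fin d) k) :=
  Ideal.span (Set.range X)

variable [Field k]

lemma exists_sub_coe_mem_varsIdeal_pow (f : MvPowerSeries (Fin d) k) (n : ℕ) :
    ∃ q : MvPolynomial (Fin d) k, f - (q : MvPowerSeries (Fin d) k) ∈ varsIdeal d k ^ n := by
  refine ⟨truncTotal n f, ?_⟩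
  let e := (toAdicCompletionAlgEquiv (Fin d) k).toLinearEquiv
  set g := f - ((truncTotal n f : MvPolynomial (Fin d) k) : MvPowerSeries (Fin d) k)
  have h1 : e g ∈ LinearMap.ker (AdicCompletion.eval (MvPolynomial.idealOfVars (Fin d) k)
      (MvPolynomial (Fin d) k) n) := by
    rw [LinearMap.mem_ker, AdicCompletion.eval_apply]
    change (toAdicCompletion (Fin d) k g).val n = 0
    rw [toAdicCompletion_apply_eq_mk_truncTotal]
    have : truncTotal n g = 0 := by
      ext m
      by_cases hm : m.degree < n
      · rw [coeff_truncTotal _ hm]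
        simp [g, coeff_truncTotal _ hm]
      · rw [coeff_truncTotal_eq_zero _ (not_lt.mp hm), MvPolynomial.coeff_zero]
    rw [this, map_zero]
  rw [← AdicCompletion.pow_smul_top_eq_ker_eval (MvPolynomial.idealOfVars_fg _ _)] at h1
  have h2 : g ∈ MvPolynomial.idealOfVars (Fin d) k ^ n •
      (⊤ : Submodule (MvPolynomial (Fin d) k) (MvPowerSeries (Fin d) k)) := by
    have := Submodule.mem_map_of_mem (f := e.symm.toLinearMap) h1
    rw [Submodule.map_smul''] at this
    have h3 : e.symm.toLinearMap (e g) = g := e.symm_apply_apply g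
    rw [h3] at this
    exact Submodule.smul_mono le_rfl le_top this
  rw [Ideal.smul_top_eq_map, Submodule.restrictScalars_mem, Ideal.map_pow] at h2
  refine Ideal.pow_right_mono ?_ n h2
  rw [MvPolynomial.idealOfVars, Ideal.map_span, Ideal.span_le]
  rintro _ ⟨_, ⟨i, rfl⟩, rfl⟩
  refine Ideal.subset_span ⟨i, ?_⟩
  exact (MvPolynomial.coe_X i).symm

lemma exists_sub_C_mem_varsIdeal (f : MvPowerSeries (Fin d) k) :
    ∃ a : k, f - C a ∈ varsIdeal d k := by
  obtain ⟨q, hq⟩ := exists_sub_coe_mem_varsIdeal_pow f 1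
  rw [pow_one] at hq
  suffices ∀ q : MvPolynomial (Fin d) k, ∃ a : k, (q : MvPowerSeries (Fin d) k) - C a ∈
      varsIdeal d k by
    obtain ⟨a, ha⟩ := this q
    exact ⟨a, by simpa using add_mem hq ha⟩
  intro q
  induction q using MvPolynomial.induction_on with
  | C a => exact ⟨a, by simp⟩
  | add p q hp hq =>
    obtain ⟨a, ha⟩ := hp
    obtain ⟨b, hb⟩ := hq
    refine ⟨a + b, ?_⟩
    have := add_mem ha hb
    rw [MvPolynomial.coe_add, map_add]
    convert this using 1
    ring
  | mul_X p i _ =>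
    refine ⟨0, ?_⟩
    rw [MvPolynomial.coe_mul, MvPolynomial.coe_X, map_zero, sub_zero]
    exact Ideal.mul_mem_left _ _ (Ideal.subset_span ⟨i, rfl⟩)

lemma maximalIdeal_eq_varsIdeal :
    IsLocalRing.maximalIdeal (MvPowerSeries (Fin d) k) = varsIdeal d k := by
  refine le_antisymm (fun f hf => ?_) (Ideal.span_le.mpr ?_)
  · obtain ⟨a, ha⟩ := exists_sub_C_mem_varsIdeal f
    have hle : varsIdeal d k ≤ IsLocalRing.maximalIdeal (MvPowerSeries (Fin d) k) := by
      refine Ideal.span_le.mpr ?_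
      rintro _ ⟨i, rfl⟩
      simp [MvPowerSeries.isUnit_iff_constantCoeff]
    have h2 : C a ∈ IsLocalRing.maximalIdeal (MvPowerSeries (Fin d) k) := by
      simpa using sub_mem hf (hle ha)
    have : a = 0 := by
      simpa [MvPowerSeries.isUnit_iff_constantCoeff] using h2
    simpa [this] using ha
  · rintro _ ⟨i, rfl⟩
    simp [MvPowerSeries.isUnit_iff_constantCoeff]

/-- Evaluation of power series at elements of an ideal for which the target is complete. -/
lemma exists_ringHom_of_isAdicComplete {B : Type*} [CommRing B] (I : Ideal B) [IsAdicComplete I B]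
    (s : k →+* B) (b : Fin d → B) (hb : ∀ j, b j ∈ I) :
    ∃ ψ : MvPowerSeries (Fin d) k →+* B, (∀ a, ψ (C a) = s a) ∧ ∀ j, ψ (X j) = b j := by
  let ev : MvPolynomial (Fin d) k →+* B := MvPolynomial.eval₂Hom s b
  have hev : ∀ n, ∀ q ∈ MvPolynomial.idealOfVars (Fin d) k ^ n, ev q ∈ I ^ n := by
    intro n q hq
    have h1 : (MvPolynomial.idealOfVars (Fin d) k).map ev ≤ I := by
      rw [MvPolynomial.idealOfVars, Ideal.map_span, Ideal.span_le]
      rintro _ ⟨_, ⟨i, rfl⟩, rfl⟩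
      simpa [ev] using hb i
    have h2 := Ideal.mem_map_of_mem ev hq
    rw [Ideal.map_pow] at h2
    exact Ideal.pow_right_mono h1 n h2
  let f : ∀ n, MvPowerSeries (Fin d) k →+* B ⧸ I ^ n := fun n =>
    (Ideal.quotientMap (I ^ n) ev (hev n)).comp (truncTotalAlgHom (Fin d) k n).toRingHom
  have hf : ∀ n x, f n x = Ideal.Quotient.mk (I ^ n) (ev (truncTotal n x)) := fun n x => rfl
  have hcompat : ∀ {m n : ℕ} (hle : m ≤ n),
      (Ideal.Quotient.factorPow I hle).comp (f n) = f m := by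
    intro m n hle
    ext x
    rw [RingHom.comp_apply, hf, hf]
    change Ideal.Quotient.mk (I ^ m) _ = _
    rw [Ideal.Quotient.eq, ← map_sub]
    exact hev m _ (truncTotal_sub_truncTotal_mem_pow_idealOfVars hle le_rfl x)
  let ψ := IsAdicComplete.liftRingHom I f hcompat
  have hψ : ∀ q : MvPolynomial (Fin d) k, ψ q = ev q := by
    intro q
    refine sub_eq_zero.mp (IsHausdorff.haus (I := I) inferInstance _ fun n => ?_)
    rw [SModEq.zero, smul_eq_mul, Ideal.mul_top, ← Ideal.Quotient.eq,
      IsAdicComplete.mk_liftRingHom]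
    have h1 : truncTotalAlgHom (Fin d) k n (q : MvPowerSeries (Fin d) k) =
        Ideal.Quotient.mk _ q := (truncTotalAlgHom (Fin d) k n).commutes q
    change Ideal.quotientMap (I ^ n) ev (hev n) (truncTotalAlgHom (Fin d) k n _) = _
    rw [h1]
    rfl
  refine ⟨ψ, fun a => ?_, fun j => ?_⟩
  · rw [← MvPolynomial.coe_C, hψ]
    simp [ev]
  · rw [← MvPolynomial.coe_X, hψ]
    simp [ev]

/-- The derivation of a power series ring which is given by the derivation `D` on the
coefficients and is logarithmic in the variables: it sends `X j` to `e j * X j`. -/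
noncomputable def coeffDerivation (D : Derivation ℤ k k) (e : Fin d → k) :
    Derivation ℤ (MvPowerSeries (Fin d) k) (MvPowerSeries (Fin d) k) :=
  Derivation.mk'
    (({ toFun := fun f m => D (coeff m f) + (∑ j, (m j : k) * e j) * coeff m f
        map_zero' := by funext m; simp only [map_zero, mul_zero, add_zero]; rfl
        map_add' := fun f g => by
          funext m
          change _ = (D (coeff m f) + _) + (D (coeff m g) + _)
          simp only [map_add]
          ring } : MvPowerSeries (Fin d) k →+ MvPowerSeries (Fin d) k).toIntLinearMap) (by
      classical
      intro f g
      ext m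
      change D (coeff m (f * g)) + (∑ j, (m j : k) * e j) * coeff m (f * g) = _
      rw [map_add, smul_eq_mul, smul_eq_mul, mul_comm g, coeff_mul, coeff_mul, coeff_mul, map_sum,
        Finset.mul_sum, ← Finset.sum_add_distrib, ← Finset.sum_add_distrib]
      refine Finset.sum_congr rfl fun x hx => ?_
      have hm : ∑ j, (m j : k) * e j = ∑ j, (x.1 j : k) * e j + ∑ j, (x.2 j : k) * e j := by
        rw [← Finset.HasAntidiagonal.mem_antidiagonal.mp hx, ← Finset.sum_add_distrib]
        refine Finset.sum_congr rfl fun j _ => ?_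
        rw [Finsupp.add_apply, Nat.cast_add, add_mul]
      rw [hm, Derivation.leibniz]
      change _ = coeff x.1 f * (D (coeff x.2 g) + _ * coeff x.2 g) +
        (D (coeff x.1 f) + _ * coeff x.1 f) * coeff x.2 g
      simp only [smul_eq_mul]
      ring)

lemma coeff_coeffDerivation (D : Derivation ℤ k k) (e : Fin d → k)
    (f : MvPowerSeries (Fin d) k) (m : Fin d →₀ ℕ) :
    coeff m (coeffDerivation D e f) = D (coeff m f) + (∑ j, (m j : k) * e j) * coeff m f :=
  rfl

lemma coeffDerivation_C (D : Derivation ℤ k k) (e : Fin d → k) (a : k) :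
    coeffDerivation D e (C a) = C (D a) := by
  classical
  ext m
  rw [coeff_coeffDerivation, coeff_C, coeff_C]
  by_cases hm : m = 0
  · simp [hm]
  · simp [hm]

lemma coeffDerivation_X (D : Derivation ℤ k k) (e : Fin d → k) (i : Fin d) :
    coeffDerivation D e (X i) = C (e i) * X i := by
  classical
  ext m
  rw [coeff_coeffDerivation, coeff_C_mul, coeff_X]
  by_cases hm : m = Finsupp.single i 1
  · subst hm
    rw [if_pos rfl, Finset.sum_eq_single i]
    · simp
    · intro j _ hj
      simp [hj.symm]
    · simp
  · simp [hm]

/-- A power series over a field of characteristic `p` which is killed by all the derivations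
`coeffDerivation D e` is a `p`-th power. -/
lemma exists_pow_eq_of_coeffDerivation_eq_zero (p : ℕ) [Fact p.Prime] [CharP k p]
    (f : MvPowerSeries (Fin d) k) (hf : ∀ D e, coeffDerivation D e f = 0) :
    ∃ g : MvPowerSeries (Fin d) k, g ^ p = f := by
  classical
  have hp : p ≠ 0 := (Fact.out : p.Prime).ne_zero
  have h1 : ∀ m, ∃ b : k, b ^ p = coeff m f := by
    intro m
    by_contra! h
    obtain ⟨D, hD⟩ := exists_derivation_ne_zero p _ h
    apply hD
    have := congrArg (coeff m) (hf D 0)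
    simpa [coeff_coeffDerivation] using this
  have h2 : ∀ m j, ¬ p ∣ m j → coeff m f = 0 := by
    intro m j hj
    have := congrArg (coeff m) (hf 0 (Pi.single j 1))
    rw [coeff_coeffDerivation, Finset.sum_eq_single j] at this
    · simpa [CharP.cast_eq_zero_iff k p, hj] using this
    · intro i _ hi
      simp [hi]
    · simp
  choose b hb using h1
  let g : MvPowerSeries (Fin d) k := fun m => b (p • m)
  have hg : ∀ m, coeff m g = b (p • m) := fun m => rfl
  refine ⟨g, ?_⟩
  have : ExpChar k p := ExpChar.prime Fact.out
  rw [← map_frobenius_expand p hp]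
  ext m
  rw [coeff_map]
  by_cases hm : ∀ j, p ∣ m j
  · choose c hc using hm
    have : m = p • Finsupp.equivFunOnFinite.symm c := by
      ext j
      simp [hc j]
    rw [this, coeff_expand_smul, hg, frobenius_def, hb]
  · push Not at hm
    obtain ⟨j, hj⟩ := hm
    rw [coeff_expand_of_not_dvd p hp _ hj, map_zero, h2 m j hj]

end PowerSeries

/-! ### Adic completeness -/

section Completeness

variable {R : Type*} [CommRing R] (I : Ideal R)

lemma isPrecomplete_pi {ι : Type*} [Finite ι] [IsPrecomplete I R] : IsPrecomplete I (ι → R) := by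
  classical
  cases nonempty_fintype ι
  refine ⟨fun f hf => ?_⟩
  have h1 : ∀ i, ∃ L : R, ∀ n, f n i ≡ L [SMOD (I ^ n • ⊤ : Submodule R R)] := fun i =>
    IsPrecomplete.prec inferInstance fun {m n} hmn => by
      have := SModEq.sub_mem.mp (hf hmn)
      rw [SModEq.sub_mem]
      have h2 := Submodule.mem_map_of_mem (f := (LinearMap.proj i : (ι → R) →ₗ[R] R)) this
      rw [Submodule.map_smul''] at h2
      exact Submodule.smul_mono le_rfl le_top h2
  choose L hL using h1
  refine ⟨L, fun n => ?_⟩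
  rw [SModEq.sub_mem, ← Finset.univ_sum_single (f n - L)]
  refine sum_mem fun i _ => ?_
  have h2 := Submodule.mem_map_of_mem (f := LinearMap.single R (fun _ : ι => R) i)
    (SModEq.sub_mem.mp (hL i n))
  rw [Submodule.map_smul''] at h2
  exact Submodule.smul_mono le_rfl le_top h2

lemma isPrecomplete_of_finite (M : Type*) [AddCommGroup M] [Module R M] [Module.Finite R M]
    [IsPrecomplete I R] : IsPrecomplete I M := by
  obtain ⟨n, f, hf⟩ := Module.Finite.exists_fin' R M
  have := isPrecomplete_pi I (ι := Fin n)
  rw [← AdicCompletion.of_surjective_iff]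
  intro y
  obtain ⟨x, rfl⟩ := AdicCompletion.map_surjective I hf y
  obtain ⟨x, rfl⟩ := AdicCompletion.of_surjective I _ x
  exact ⟨f x, (AdicCompletion.map_of I f x).symm⟩

/-- A finite local algebra `B` over a complete local ring `R` is complete for the ideal generated
by the maximal ideal of `R`. -/
lemma isAdicComplete_map_of_finite [IsLocalRing R] [IsNoetherianRing R]
    [IsAdicComplete (IsLocalRing.maximalIdeal R) R] (B : Type*) [CommRing B] [Algebra R B]
    [Module.Finite R B] :
    IsAdicComplete ((IsLocalRing.maximalIdeal R).map (algebraMap R B)) B := by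
  rw [IsAdicComplete.map_algebraMap_iff]
  have := isPrecomplete_of_finite (IsLocalRing.maximalIdeal R) B
  exact { }

/-- The complete version of Nakayama's lemma. -/
lemma exists_eq_sum_of_sub_mem [IsPrecomplete I R] {B : Type*} [CommRing B] (ψ : R →+* B)
    [IsHausdorff (I.map ψ) B] {ι : Type*} [Fintype ι] (v : ι → B)
    (h : ∀ b, ∃ c : ι → R, b - ∑ i, ψ (c i) * v i ∈ I.map ψ) (b : B) :
    ∃ c : ι → R, b = ∑ i, ψ (c i) * v i := by
  let _ := ψ.toAlgebra
  let f : (ι → R) →ₗ[R] B := Fintype.linearCombination R v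
  have hf : ∀ c, f c = ∑ i, ψ (c i) * v i := fun c => by
    simp [f, Fintype.linearCombination_apply, Algebra.smul_def, RingHom.algebraMap_toAlgebra]
  have := isPrecomplete_pi I (ι := ι)
  have : IsHausdorff I B :=
    (IsHausdorff.map_algebraMap_iff (S := B)).mp ‹IsHausdorff (I.map ψ) B›
  have hsurj : Function.Surjective f := by
    apply surjective_of_mkQ_comp_surjective (I := I)
    intro y
    obtain ⟨b, rfl⟩ := Submodule.mkQ_surjective _ y
    obtain ⟨c, hc⟩ := h b
    refine ⟨c, ?_⟩
    rw [LinearMap.comp_apply, Submodule.mkQ_apply, Submodule.mkQ_apply, eq_comm,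
      Submodule.Quotient.eq, hf, Ideal.smul_top_eq_map]
    exact hc
  obtain ⟨c, hc⟩ := hsurj b
  exact ⟨c, by rw [← hc, hf]⟩

/-- A ring which is complete for an ideal is complete for each principal ideal contained in it. -/
lemma isAdicComplete_span_singleton [IsAdicComplete I R] {w : R} (hw : w ∈ I) :
    IsAdicComplete (Ideal.span {w}) R := by
  have hle : Ideal.span {w} ≤ I := (Ideal.span_singleton_le_iff_mem I).mpr hw
  have hmem : ∀ n x, x ∈ (Ideal.span {w} ^ n • ⊤ : Submodule R R) ↔ w ^ n ∣ x := fun n x => by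
    rw [smul_eq_mul, Ideal.mul_top, Ideal.span_singleton_pow, Ideal.mem_span_singleton]
  refine { haus' := fun x hx => ?_, prec' := fun f hf => ?_ }
  · refine IsHausdorff.haus (I := I) inferInstance x fun n => ?_
    have := SModEq.zero.mp (hx n)
    exact SModEq.zero.mpr (Submodule.smul_mono (Ideal.pow_right_mono hle n) le_rfl this)
  · have hb : ∀ n, ∃ b, f (n + 1) - f n = w ^ n * b := fun n => by
      have := SModEq.sub_mem.mp (hf (Nat.le_succ n)).symm
      exact (hmem n _).mp this
    choose b hb using hb
    -- the tails `∑_{j} w ^ j * b (n + j)` converge in the coarser topology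
    let S : ℕ → ℕ → R := fun n r => ∑ j ∈ Finset.range r, w ^ j * b (n + j)
    have hS : ∀ n, ∃ t, ∀ r, S n r ≡ t [SMOD (I ^ r • ⊤ : Submodule R R)] := fun n =>
      IsPrecomplete.prec inferInstance fun {r s} hrs => by
        rw [SModEq.comm, SModEq.sub_mem, smul_eq_mul, Ideal.mul_top]
        obtain ⟨m, rfl⟩ := Nat.exists_eq_add_of_le hrs
        have : S n (r + m) - S n r = ∑ j ∈ Finset.range m, w ^ (r + j) * b (n + (r + j)) := by
          simp only [S]
          rw [Finset.sum_range_add, add_sub_cancel_left]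
        rw [this]
        refine sum_mem fun j _ => Ideal.mul_mem_right _ _ ?_
        rw [pow_add]
        exact Ideal.mul_mem_right _ _ (Ideal.pow_mem_pow hw r)
    choose t ht using hS
    have hfS : ∀ n r, f (n + r) = f n + w ^ n * S n r := by
      intro n r
      induction r with
      | zero => simp [S]
      | succ r ih =>
        have h1 : S n (r + 1) = S n r + w ^ r * b (n + r) := Finset.sum_range_succ _ _
        have h2 := hb (n + r)
        rw [← add_assoc, sub_eq_iff_eq_add.mp h2, ih, h1]
        ring
    refine ⟨f 0 + t 0, fun n => ?_⟩
    rw [SModEq.comm, SModEq.sub_mem, hmem]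
    refine ⟨t n, ?_⟩
    rw [← sub_eq_zero]
    refine IsHausdorff.haus (I := I) inferInstance _ fun r => SModEq.zero.mpr ?_
    have h1 := SModEq.sub_mem.mp (ht n r)
    have h2 := SModEq.sub_mem.mp (ht 0 (n + r))
    rw [smul_eq_mul, Ideal.mul_top] at h1 h2 ⊢
    have h3 := hfS n r
    have h4 := hfS 0 (n + r)
    rw [zero_add, pow_zero, one_mul] at h4
    have h5 : f 0 + t 0 - f n - w ^ n * t n =
        w ^ n * (S n r - t n) - (S 0 (n + r) - t 0) := by
      linear_combination h3 - h4
    rw [h5]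
    exact sub_mem (Ideal.mul_mem_left _ _ h1) (Ideal.pow_le_pow_right (Nat.le_add_left r n) h2)

end Completeness

/-! ### Perturbing a homomorphism out of a power series ring -/

section Perturbation

open MvPowerSeries

variable {d : ℕ} {k : Type*} [Field k] {B : Type*} [CommRing B]

lemma coeffDerivation_mem_varsIdeal_pow (D : Derivation ℤ k k) (e : Fin d → k) (n : ℕ) :
    ∀ f ∈ varsIdeal d k ^ n, coeffDerivation D e f ∈ varsIdeal d k ^ n := by
  have h1 : ∀ f ∈ varsIdeal d k, coeffDerivation D e f ∈ varsIdeal d k := by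
    intro f hf
    induction hf using Submodule.span_induction with
    | mem f hf =>
      obtain ⟨j, rfl⟩ := hf
      rw [coeffDerivation_X]
      exact Ideal.mul_mem_left _ _ (Ideal.subset_span ⟨j, rfl⟩)
    | zero => simp
    | add f g _ _ hf hg => simpa using add_mem hf hg
    | smul a f hf' hf =>
      rw [smul_eq_mul, Derivation.leibniz]
      exact add_mem (Ideal.mul_mem_left _ _ hf) (Ideal.mul_mem_right _ _ hf')
  induction n with
  | zero => simp
  | succ n ih =>
    intro f hf
    rw [pow_succ] at hf ⊢
    induction hf using Submodule.mul_induction_on' with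
    | mem_mul_mem a ha b hb =>
      rw [Derivation.leibniz, smul_eq_mul, smul_eq_mul, mul_comm b]
      exact add_mem (Ideal.mul_mem_mul ha (h1 b hb)) (Ideal.mul_mem_mul (ih a ha) hb)
    | add a _ b _ ha hb => simpa using add_mem ha hb

/-- Ideals of a noetherian local ring are closed, by Krull's intersection theorem. -/
lemma mem_of_forall_mem_sup_pow [IsLocalRing B] [IsNoetherianRing B] {I : Ideal B} (hI : I ≠ ⊤)
    (J : Ideal B) (x : B) (hx : ∀ n, x ∈ J ⊔ I ^ n) : x ∈ J := by
  have := IsHausdorff.of_isLocalRing I (B ⧸ J) hI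
  rw [← Ideal.Quotient.eq_zero_iff_mem]
  refine IsHausdorff.haus this _ fun n => SModEq.zero.mpr ?_
  obtain ⟨j, hj, i, hi, rfl⟩ := Submodule.mem_sup.mp (hx n)
  have h : Ideal.Quotient.mk J (j + i) = i • (1 : B ⧸ J) := by
    rw [map_add, Ideal.Quotient.eq_zero_iff_mem.mpr hj, zero_add, Algebra.smul_def, mul_one]
    rfl
  rw [h]
  exact Submodule.smul_mem_smul hi trivial

/-- Let `ψ : k⟦X⟧ → B` be a homomorphism to a complete noetherian local ring of characteristic `p`
and let `w` be an element of the ideal of definition. Each derivation `coeffDerivation D e` lifts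
to a homomorphism congruent to `ψ + w ψ ∘ coeffDerivation D e` modulo `w ^ 2`: on `k` by formal
smoothness of `k` over the prime field, and on the variables by an explicit choice. -/
lemma exists_perturbation (p : ℕ) [Fact p.Prime] [CharP k p] [CharP B p] [IsLocalRing B]
    [IsNoetherianRing B] {I : Ideal B} (hI : I ≠ ⊤) [IsAdicComplete I B]
    (ψ : MvPowerSeries (Fin d) k →+* B) (hψ : ∀ j, ψ (X j) ∈ I) (D : Derivation ℤ k k)
    (e : Fin d → k) {w : B} (hw : w ∈ I) :
    ∃ ψ' : MvPowerSeries (Fin d) k →+* B,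
      (∀ j, ψ' (X j) = ψ (X j) * (1 + w * ψ (C (e j)))) ∧
      ∀ r, ∃ b, ψ' r = ψ r + w * ψ (coeffDerivation D e r) + w ^ 2 * b := by
  let _ : Algebra (ZMod p) k := ZMod.algebra k p
  let _ : Algebra (ZMod p) B := ZMod.algebra B p
  have := formallySmooth_zmod p k
  let J : Ideal B := Ideal.span {w ^ 2}
  have hw2 : w ^ 2 ∈ I := Ideal.pow_mem_of_mem I hw 2 two_pos
  have := isAdicComplete_span_singleton I hw2
  have hwJ : Ideal.Quotient.mk J w * Ideal.Quotient.mk J w = 0 := by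
    rw [← map_mul, ← pow_two]
    exact Ideal.Quotient.eq_zero_iff_mem.mpr (Ideal.mem_span_singleton_self _)
  let σ : k →+* B ⧸ J :=
    { toFun := fun a => Ideal.Quotient.mk J (ψ (C a) + w * ψ (C (D a)))
      map_zero' := by simp
      map_one' := by simp
      map_add' := fun a b => by simp only [map_add, mul_add]; ring
      map_mul' := fun a b => by
        simp only [Derivation.leibniz, smul_eq_mul, map_add, map_mul]
        linear_combination (-Ideal.Quotient.mk J (ψ (C (D a))) *
          Ideal.Quotient.mk J (ψ (C (D b)))) * hwJ }
  have hσ : ∀ a, σ a = Ideal.Quotient.mk J (ψ (C a) + w * ψ (C (D a))) := fun a => rfl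
  let σ' : k →ₐ[ZMod p] B ⧸ J :=
    { σ with
      commutes' := fun r => RingHom.congr_fun
        (Subsingleton.elim (σ.comp (algebraMap (ZMod p) k)) (algebraMap (ZMod p) (B ⧸ J))) r }
  obtain ⟨g, hg⟩ := Algebra.FormallySmooth.exists_mkₐ_comp_eq_of_isAdicComplete (I := J) σ'
  have hg' : ∀ a, g a - (ψ (C a) + w * ψ (C (D a))) ∈ J := fun a => by
    rw [← Ideal.Quotient.eq, ← hσ]
    exact congrArg (fun h : k →ₐ[ZMod p] B ⧸ J => h a) hg
  obtain ⟨ψ', hC, hX⟩ := exists_ringHom_of_isAdicComplete I g.toRingHom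
    (fun j => ψ (X j) * (1 + w * ψ (C (e j)))) (fun j => Ideal.mul_mem_right _ _ (hψ j))
  refine ⟨ψ', hX, ?_⟩
  -- on polynomials the congruence holds since both sides are ring homomorphisms modulo `w ^ 2`
  have hpoly : ∀ q : MvPolynomial (Fin d) k,
      ψ' q - (ψ q + w * ψ (coeffDerivation D e q)) ∈ J := by
    intro q
    induction q using MvPolynomial.induction_on with
    | C a =>
      rw [MvPolynomial.coe_C, hC, coeffDerivation_C]
      exact hg' a
    | add p q hp hq =>
      have := add_mem hp hq
      rw [MvPolynomial.coe_add]
      simp only [map_add]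
      convert this using 1
      ring
    | mul_X q j hq =>
      rw [MvPolynomial.coe_mul, MvPolynomial.coe_X, Derivation.leibniz, coeffDerivation_X]
      simp only [map_add, map_mul, hX, smul_eq_mul]
      obtain ⟨c, hc⟩ := Ideal.mem_span_singleton.mp hq
      rw [sub_eq_iff_eq_add.mp hc]
      refine Ideal.mem_span_singleton.mpr
        ⟨c * (ψ (X j) * (1 + w * ψ (C (e j)))) +
          ψ (coeffDerivation D e q) * ψ (X j) * ψ (C (e j)), ?_⟩
      ring
  have hmap : ∀ φ : MvPowerSeries (Fin d) k →+* B, (∀ j, φ (X j) ∈ I) →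
      ∀ n, ∀ f ∈ varsIdeal d k ^ n, φ f ∈ I ^ n := by
    intro φ hφ n f hf
    have h1 := Ideal.mem_map_of_mem φ hf
    rw [Ideal.map_pow, Ideal.map_span] at h1
    refine Ideal.pow_right_mono (Ideal.span_le.mpr ?_) n h1
    rintro _ ⟨_, ⟨j, rfl⟩, rfl⟩
    exact hφ j
  intro r
  suffices h : ψ' r - (ψ r + w * ψ (coeffDerivation D e r)) ∈ J by
    obtain ⟨b, hb⟩ := Ideal.mem_span_singleton.mp h
    exact ⟨b, by rw [← hb]; ring⟩
  refine mem_of_forall_mem_sup_pow hI J _ fun n => ?_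
  obtain ⟨q, hq⟩ := exists_sub_coe_mem_varsIdeal_pow r n
  set t := r - (q : MvPowerSeries (Fin d) k)
  have hr : r = q + t := by simp [t]
  have h1 : ψ' t - (ψ t + w * ψ (coeffDerivation D e t)) ∈ I ^ n := by
    refine sub_mem (hmap ψ' (fun j => ?_) n t hq) (add_mem (hmap ψ hψ n t hq)
      (Ideal.mul_mem_left _ _ (hmap ψ hψ n _ (coeffDerivation_mem_varsIdeal_pow D e n t hq))))
    rw [hX]
    exact Ideal.mul_mem_right _ _ (hψ j)
  rw [hr]
  simp only [map_add]
  convert add_mem (Ideal.mem_sup_left (hpoly q)) (Ideal.mem_sup_right (S := J) h1) using 1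
  ring

end Perturbation

/-! ### Derivations and perturbed homomorphisms -/

section Calculation

open Polynomial

variable {R B M : Type*} [CommRing R] [CommRing B] [AddCommGroup M] [Module B M]

/-- `f.derivEval ψ D z` is the value at `z` of the polynomial obtained from `f` by applying the
additive map `D` to its coefficients. -/
noncomputable def Polynomial.derivEval (f : R[X]) (ψ : R →+* B) (D : R →+ R) (z : B) :
    B :=
  f.sum fun j a => ψ (D a) * z ^ j

lemma Polynomial.derivEval_add (f g : R[X]) (ψ : R →+* B) (D : R →+ R) (z : B) :
    (f + g).derivEval ψ D z = f.derivEval ψ D z + g.derivEval ψ D z :=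
  Polynomial.sum_add_index _ _ _ (by simp) (by simp [add_mul])

lemma Polynomial.derivEval_monomial (j : ℕ) (a : R) (ψ : R →+* B) (D : R →+ R) (z : B) :
    (monomial j a).derivEval ψ D z = ψ (D a) * z ^ j :=
  Polynomial.sum_monomial_index _ _ (by simp)

lemma Derivation.map_pow_succ_mul (δ : Derivation ℤ B M) (z x : B) (n : ℕ) :
    δ (z ^ (n + 1) * x) = (((n + 1 : ℕ) : B) * z ^ n * x) • δ z + z ^ (n + 1) • δ x := by
  rw [Derivation.leibniz, Derivation.leibniz_pow, add_comm, Nat.add_sub_cancel,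
    ← Nat.cast_smul_eq_nsmul B, smul_smul, smul_smul]
  congr 2
  ring

/-- Let `ψ'` be congruent to `ψ + z ^ N ψ ∘ D` modulo `z ^ (2 N)`, where `N = n + 1`. A derivation
`δ` of `B = ψ'(R)[z]` which vanishes on `ψ'(R)` is then nearly zero on `ψ(R)`, and this gives the
leading terms of the value of `δ` at a polynomial in `z` with coefficients in `ψ(R)`. -/
lemma Derivation.exists_map_eval₂_eq {ψ ψ' : R →+* B} {D : R →+ R} {z : B} {n : ℕ}
    (hψ' : ∀ r, ∃ b, ψ' r = ψ r + z ^ (n + 1) * ψ (D r) + (z ^ (n + 1)) ^ 2 * b)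
    (δ : Derivation ℤ B M) (hδ : ∀ r, δ (ψ' r) = 0) (hB : ∀ b, ∃ c : B, δ b = c • δ z)
    (f : R[X]) :
    ∃ c : B, δ (f.eval₂ ψ z) = (f.derivative.eval₂ ψ z -
      ((n + 1 : ℕ) : B) * z ^ n * f.derivEval ψ D z + z ^ (2 * n + 1) * c) • δ z := by
  have h0 : ∀ r, ∃ b, δ (ψ r) = -δ (z ^ (n + 1) * ψ (D r)) - δ (z ^ (2 * n + 1 + 1) * b) := by
    intro r
    obtain ⟨b, hb⟩ := hψ' r
    refine ⟨b, ?_⟩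
    have h1 : ψ r = ψ' r - z ^ (n + 1) * ψ (D r) - z ^ (2 * n + 1 + 1) * b := by
      rw [hb]
      ring
    rw [h1, map_sub, map_sub, hδ, zero_sub]
  have h1 : ∀ r, ∃ c : B, δ (ψ r) = (z ^ n * c) • δ z := by
    intro r
    obtain ⟨b, hb⟩ := h0 r
    obtain ⟨c₁, hc₁⟩ := hB (ψ (D r))
    obtain ⟨c₂, hc₂⟩ := hB b
    rw [hb, Derivation.map_pow_succ_mul, Derivation.map_pow_succ_mul, hc₁, hc₂]
    refine ⟨-(((n + 1 : ℕ) : B) * ψ (D r) + z * c₁ +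
      ((2 * n + 1 + 1 : ℕ) : B) * z ^ (n + 1) * b + z ^ (n + 2) * c₂), ?_⟩
    simp only [smul_smul, ← add_smul, ← neg_smul, ← sub_smul]
    congr 1
    ring
  have h2 : ∀ r, ∃ c : B, δ (ψ r) =
      (-(((n + 1 : ℕ) : B) * z ^ n * ψ (D r)) + z ^ (2 * n + 1) * c) • δ z := by
    intro r
    obtain ⟨b, hb⟩ := h0 r
    obtain ⟨c₁, hc₁⟩ := h1 (D r)
    obtain ⟨c₂, hc₂⟩ := hB b
    rw [hb, Derivation.map_pow_succ_mul, Derivation.map_pow_succ_mul, hc₁, hc₂]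
    refine ⟨-(c₁ + ((2 * n + 1 + 1 : ℕ) : B) * b + z * c₂), ?_⟩
    simp only [smul_smul, ← add_smul, ← neg_smul, ← sub_smul]
    congr 1
    ring
  induction f using Polynomial.induction_on' with
  | add f g hf hg =>
    obtain ⟨c₁, hc₁⟩ := hf
    obtain ⟨c₂, hc₂⟩ := hg
    refine ⟨c₁ + c₂, ?_⟩
    rw [eval₂_add, map_add, hc₁, hc₂, derivative_add, eval₂_add, derivEval_add, ← add_smul]
    congr 1
    ring
  | monomial j a =>
    obtain ⟨c, hc⟩ := h2 a
    refine ⟨c * z ^ j, ?_⟩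
    rw [eval₂_monomial, derivative_monomial, eval₂_monomial, derivEval_monomial,
      Derivation.leibniz, hc, Derivation.leibniz_pow, ← Nat.cast_smul_eq_nsmul B, smul_smul,
      smul_smul, smul_smul, ← add_smul, map_mul, _root_.map_natCast ψ]
    congr 1
    ring

end Calculation

/-! ### Separability over the image of a homomorphism -/

section Separability

open Polynomial

universe u

variable {R : Type*} {B : Type u} [CommRing R] [CommRing B]

/-- The image of `z` in the fraction field of `B ⧸ Q` is a simple root of a polynomial with
coefficients in the image of `ψ`. -/
def IsSepAt (ψ : R →+* B) (z : B) (Q : Ideal B) : Prop :=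
  ∃ f : R[X], f.eval₂ ψ z ∈ Q ∧ f.derivative.eval₂ ψ z ∉ Q

/-- The derivation `δ : B → M` comes from a derivation of the fraction field of `B ⧸ Q` to a
vector space: `δ` vanishes on `Q`, and the elements outside of `Q` are nonzerodivisors on `M`. -/
structure Derivation.IsGenericAt {M : Type*} [AddCommGroup M] [Module B M]
    (δ : Derivation ℤ B M) (Q : Ideal B) : Prop where
  map_eq_zero : ∀ x ∈ Q, δ x = 0
  eq_zero_of_smul : ∀ b ∉ Q, ∀ m : M, b • m = 0 → m = 0

lemma Derivation.map_eval₂_of_map_eq_zero {M : Type*} [AddCommGroup M] [Module B M]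
    (δ : Derivation ℤ B M) (ψ : R →+* B) (hδ : ∀ r, δ (ψ r) = 0) (z : B) (f : R[X]) :
    δ (f.eval₂ ψ z) = f.derivative.eval₂ ψ z • δ z := by
  induction f using Polynomial.induction_on' with
  | add f g hf hg => rw [eval₂_add, map_add, hf, hg, derivative_add, eval₂_add, add_smul]
  | monomial j a =>
    rw [eval₂_monomial, derivative_monomial, eval₂_monomial, Derivation.leibniz, hδ, smul_zero,
      add_zero, Derivation.leibniz_pow, ← Nat.cast_smul_eq_nsmul B, smul_smul, smul_smul, map_mul,
      _root_.map_natCast ψ]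

lemma IsSepAt.derivation_eq_zero {ψ : R →+* B} {z : B} {Q : Ideal B} (h : IsSepAt ψ z Q)
    {M : Type*} [AddCommGroup M] [Module B M] {δ : Derivation ℤ B M} (hQ : δ.IsGenericAt Q)
    (hδ : ∀ r, δ (ψ r) = 0) : δ z = 0 := by
  obtain ⟨f, hf, hf'⟩ := h
  refine hQ.eq_zero_of_smul _ hf' _ ?_
  rw [← δ.map_eval₂_of_map_eq_zero ψ hδ, hQ.map_eq_zero _ hf]

/-- If all generic derivations of `B` at `Q` over `R` vanish, then the fraction field of `B ⧸ Q`
is separable over that of `R`. -/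
lemma isSepAt_of_derivation_eq_zero [IsDomain R] (ψ : R →+* B) (hψ : ψ.Finite) (Q : Ideal B)
    [Q.IsPrime] (hQ : Q.comap ψ = ⊥)
    (h : ∀ (M : Type u) [AddCommGroup M] [Module B M] (δ : Derivation ℤ B M), δ.IsGenericAt Q →
      (∀ r, δ (ψ r) = 0) → ∀ b, δ b = 0) (z : B) : IsSepAt ψ z Q := by
  let _ : Algebra R B := ψ.toAlgebra
  have hfin : Module.Finite R B := hψ
  let F := FractionRing (B ⧸ Q)
  have hinj : Function.Injective (algebraMap R F) := by
    rw [injective_iff_map_eq_zero]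
    intro r hr
    rw [IsScalarTower.algebraMap_apply R (B ⧸ Q) F,
      (injective_iff_map_eq_zero' _).mp (IsFractionRing.injective (B ⧸ Q) F)] at hr
    have : algebraMap R B r ∈ Q := Ideal.Quotient.eq_zero_iff_mem.mp hr
    replace this : r ∈ Q.comap ψ := this
    rwa [hQ] at this
  have hB : ∀ b, b ∉ Q → algebraMap B F b ≠ 0 := by
    intro b hb h0
    rw [IsScalarTower.algebraMap_apply B (B ⧸ Q) F,
      (injective_iff_map_eq_zero' _).mp (IsFractionRing.injective (B ⧸ Q) F)] at h0
    exact hb (Ideal.Quotient.eq_zero_iff_mem.mp h0)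
  have hB' : ∀ b ∈ Q, algebraMap B F b = 0 := by
    intro b hb
    rw [IsScalarTower.algebraMap_apply B (B ⧸ Q) F]
    have : algebraMap B (B ⧸ Q) b = 0 := Ideal.Quotient.eq_zero_iff_mem.mpr hb
    rw [this, map_zero]
  have hδ : ∀ b, KaehlerDifferential.D R F (algebraMap B F b) = 0 := by
    refine h Ω[F⁄R] (((KaehlerDifferential.D R F).restrictScalars ℤ).compAlgebraMap B)
      ⟨fun x hx => ?_, fun b hb m hm => ?_⟩ fun r => ?_
    · change KaehlerDifferential.D R F (algebraMap B F x) = 0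
      rw [hB' x hx, map_zero]
    · rw [← algebraMap_smul F b m] at hm
      exact (smul_eq_zero.mp hm).resolve_left (hB b hb)
    · change KaehlerDifferential.D R F (algebraMap B F (algebraMap R B r)) = 0
      rw [← IsScalarTower.algebraMap_apply, Derivation.map_algebraMap]
  have hD : ∀ x, KaehlerDifferential.D R F x = 0 := by
    intro x
    obtain ⟨a, b, -, rfl⟩ := IsFractionRing.div_surjective (A := B ⧸ Q) x
    obtain ⟨a, rfl⟩ := Ideal.Quotient.mk_surjective a
    obtain ⟨b, rfl⟩ := Ideal.Quotient.mk_surjective b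
    have h1 := hδ a
    have h2 := hδ b
    rw [IsScalarTower.algebraMap_apply B (B ⧸ Q) F] at h1 h2
    rw [Derivation.leibniz_div]
    erw [h1, h2]
    simp
  have hsub : Subsingleton Ω[F⁄R] := by
    rw [← Submodule.subsingleton_iff F, ← subsingleton_iff_bot_eq_top,
      ← KaehlerDifferential.span_range_derivation, eq_comm, Submodule.span_eq_bot]
    rintro _ ⟨x, rfl⟩
    exact hD x
  have : Algebra.FormallyUnramified R F := ⟨hsub⟩
  let K := FractionRing R
  have : FaithfulSMul R F := (faithfulSMul_iff_algebraMap_injective R F).mpr hinj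
  let _ : Algebra K F := FractionRing.liftAlgebra R F
  have : IsScalarTower R K F := FractionRing.isScalarTower_liftAlgebra R F
  have : Algebra.FormallyUnramified K F := .of_restrictScalars R K F
  have : Algebra.EssFiniteType (B ⧸ Q) F :=
    Algebra.EssFiniteType.of_isLocalization F (nonZeroDivisors (B ⧸ Q))
  have : Algebra.EssFiniteType R F := Algebra.EssFiniteType.comp R (B ⧸ Q) F
  have : Algebra.EssFiniteType K F := Algebra.EssFiniteType.of_comp R K F
  have : Algebra.IsSeparable K F := Algebra.FormallyUnramified.isSeparable K F
  let x : F := algebraMap B F z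
  have hsep : (minpoly K x).Separable := Algebra.IsSeparable.isSeparable K x
  obtain ⟨b, hb0, hb⟩ := IsLocalization.integerNormalization_spec (nonZeroDivisors R)
    (minpoly K x)
  let f := IsLocalization.integerNormalization (nonZeroDivisors R) (minpoly K x)
  have hf : ∀ g : R[X], algebraMap B F (g.eval₂ ψ z) = aeval x (g.map (algebraMap R K)) := by
    intro g
    rw [aeval_map_algebraMap, aeval_def, hom_eval₂]
    rfl
  refine ⟨f, ?_, fun hmem => ?_⟩
  · by_contra hmem
    refine hB _ hmem ?_
    rw [hf, hb, ← algebraMap_smul K b, map_smul, minpoly.aeval, smul_zero]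
  · have h1 := hB' _ hmem
    rw [hf, ← derivative_map, hb] at h1
    have h2 : b • minpoly K x = C (algebraMap R K b) * minpoly K x := by
      rw [← algebraMap_smul K b, smul_eq_C_mul]
    have h3 : algebraMap R K b ≠ 0 :=
      IsFractionRing.to_map_ne_zero_of_mem_nonZeroDivisors hb0
    rw [h2, derivative_C_mul, map_mul, aeval_C] at h1
    rcases mul_eq_zero.mp h1 with h5 | h5
    · exact h3 ((map_eq_zero_iff _ (algebraMap K F).injective).mp h5)
    · exact hsep.aeval_derivative_ne_zero (minpoly.aeval K x) h5

end Separability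

section Inseparability

open Polynomial

variable {d : ℕ} {k : Type*} [Field k] {B : Type*} [CommRing B]

/-- If `z` is inseparable over the image of `ψ` at `Q`, then `z` is a root of a polynomial with zero
derivative, and of minimal degree, whose leading coefficient is a `p`-th power. As this polynomial
is not itself the `p`-th power of a polynomial, one of its coefficients is not a `p`-th power, and
some derivation of the coefficients turns it into a nonzero polynomial of smaller degree, which
does not have `z` as a root. -/
lemma exists_derivEval_notMem_of_not_isSepAt (p : ℕ) [Fact p.Prime] [CharP k p]
    (ψ : MvPowerSeries (Fin d) k →+* B) (hψ : ψ.Finite) (Q : Ideal B) [Q.IsPrime]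
    (hQ : Q.comap ψ = ⊥) {z : B} (hz : ¬ IsSepAt ψ z Q) :
    ∃ (D : Derivation ℤ k k) (e : Fin d → k) (f : (MvPowerSeries (Fin d) k)[X]),
      f.eval₂ ψ z ∈ Q ∧ f.derivative = 0 ∧ f.derivEval ψ (coeffDerivation D e : _ →+ _) z ∉ Q := by
  classical
  have hp : p.Prime := Fact.out
  have : CharP (MvPowerSeries (Fin d) k) p :=
    charP_of_injective_ringHom (MvPowerSeries.C_injective (σ := Fin d) (R := k)) p
  have hex : ∃ n, ∃ f : (MvPowerSeries (Fin d) k)[X], f ≠ 0 ∧ f.natDegree = n ∧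
      f.eval₂ ψ z ∈ Q := by
    obtain ⟨f, hf, hfz⟩ := hψ.to_isIntegral z
    exact ⟨_, f, hf.ne_zero, rfl, by rw [hfz]; exact Q.zero_mem⟩
  obtain ⟨f₀, hf₀, hn, hf₀z⟩ := Nat.find_spec hex
  set n := Nat.find hex
  have hmin : ∀ g : (MvPowerSeries (Fin d) k)[X], g.eval₂ ψ z ∈ Q → g.natDegree < n → g = 0 := by
    intro g hg hgn
    by_contra h0
    exact Nat.find_min hex hgn ⟨g, h0, rfl, hg⟩
  have hnpos : 0 < n := by
    by_contra h0
    have h1 : f₀.natDegree = 0 := by omega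
    rw [eq_C_of_natDegree_eq_zero h1, eval₂_C] at hf₀z
    have h2 : f₀.coeff 0 ∈ Q.comap ψ := hf₀z
    rw [hQ, Ideal.mem_bot] at h2
    exact hf₀ (by rw [eq_C_of_natDegree_eq_zero h1, h2, C_0])
  set l := f₀.leadingCoeff
  have hl : l ≠ 0 := leadingCoeff_ne_zero.mpr hf₀
  let f := C (l ^ (p - 1)) * f₀
  have hfn : f.natDegree = n := by
    rw [natDegree_C_mul (pow_ne_zero _ hl), hn]
  have hfl : f.coeff n = l ^ p := by
    have hpp : p = p - 1 + 1 := by have := hp.pos; omega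
    rw [coeff_C_mul, ← hn]
    change l ^ (p - 1) * l = _
    conv_rhs => rw [hpp, pow_succ]
  have hf0 : f ≠ 0 := mul_ne_zero (by simpa using pow_ne_zero _ hl) hf₀
  have hfz : f.eval₂ ψ z ∈ Q := by
    rw [eval₂_mul]
    exact Ideal.mul_mem_left _ _ hf₀z
  have hf' : f.derivative = 0 := by
    by_contra h0
    refine hz ⟨f, hfz, fun h1 => h0 (hmin _ h1 ?_)⟩
    rw [← hfn]
    exact natDegree_derivative_lt (by omega)
  by_contra! hcon
  have hD : ∀ D e j, coeffDerivation D e (f.coeff j) = 0 := by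
    intro D e j
    let g : (MvPowerSeries (Fin d) k)[X] :=
      ∑ i ∈ Finset.range (n + 1), monomial i (coeffDerivation D e (f.coeff i))
    have hg : ∀ i, g.coeff i = coeffDerivation D e (f.coeff i) := by
      intro i
      simp only [g, finsetSum_coeff, coeff_monomial, Finset.sum_ite_eq', Finset.mem_range]
      split_ifs with hi
      · rfl
      · rw [coeff_eq_zero_of_natDegree_lt (by omega), map_zero]
    have hgz : g.eval₂ ψ z ∈ Q := by
      have h1 := hcon D e f hfz hf'
      have h2 : g.eval₂ ψ z = f.derivEval ψ (coeffDerivation D e : _ →+ _) z := by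
        rw [derivEval, sum_over_range' _ (by simp) (n + 1) (by omega)]
        simp only [g, eval₂_finsetSum, eval₂_monomial]
        rfl
      rwa [h2]
    have hgn : g.natDegree < n := by
      have hle : g.natDegree ≤ n := natDegree_le_iff_coeff_eq_zero.mpr fun i hi => by
        rw [hg, coeff_eq_zero_of_natDegree_lt (by omega), map_zero]
      refine lt_of_le_of_ne hle fun heq => ?_
      have h0 : g.coeff n = 0 := by
        rw [hg, hfl, Derivation.leibniz_pow, ← Nat.cast_smul_eq_nsmul (MvPowerSeries (Fin d) k),
          CharP.cast_eq_zero, zero_smul]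
      rw [← heq, coeff_natDegree, leadingCoeff_eq_zero] at h0
      rw [h0, natDegree_zero] at heq
      omega
    rw [← hg, hmin g hgz hgn, coeff_zero]
  have hpow : ∀ j, ∃ b, b ^ p = f.coeff j := fun j =>
    exists_pow_eq_of_coeffDerivation_eq_zero p _ fun D e => hD D e j
  obtain ⟨h, hh⟩ : ∃ h : (MvPowerSeries (Fin d) k)[X],
      h.map (frobenius (MvPowerSeries (Fin d) k) p) = contract p f := by
    have : contract p f ∈ lifts (frobenius (MvPowerSeries (Fin d) k) p) := by
      rw [lifts_iff_coeff_lifts]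
      intro j
      obtain ⟨b, hb⟩ := hpow (j * p)
      exact ⟨b, by rw [coeff_contract hp.ne_zero, frobenius_def, hb]⟩
    exact (mem_lifts _).mp this
  have hhf : h ^ p = f := by
    rw [← map_frobenius_expand p, map_expand, hh, expand_contract p hf' hp.ne_zero]
  have hhz : h.eval₂ ψ z ∈ Q := by
    refine Ideal.IsPrime.mem_of_pow_mem ‹_› p ?_
    rw [← eval₂_pow, hhf]
    exact hfz
  have hhn : p * h.natDegree = n := by rw [← hfn, ← hhf, natDegree_pow]
  have hh0 : h = 0 := hmin h hhz (by
    have := hp.two_le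
    nlinarith)
  exact hf0 (by rw [← hhf, hh0, zero_pow hp.ne_zero])

end Inseparability

/-! ### Making one generator separable -/

section Monogenic

open Filter

universe u

variable {d : ℕ} {k : Type*} [Field k] {B : Type u} [CommRing B]

/-- The powers `z ^ i` with `i < s` generate `B` as a module over the image of `ψ`. -/
def PowersSpan {R : Type*} [CommRing R] (ψ : R →+* B) (s : ℕ) (z : B) : Prop :=
  ∀ b, ∃ c : Fin s → R, b = ∑ i, ψ (c i) * z ^ (i : ℕ)

lemma PowersSpan.finite {R : Type*} [CommRing R] {ψ : R →+* B} {s : ℕ} {z : B}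
    (h : PowersSpan ψ s z) : ψ.Finite := by
  let _ := ψ.toAlgebra
  refine Module.Finite.of_surjective
    (Fintype.linearCombination R fun i : Fin s => z ^ (i : ℕ)) fun b => ?_
  obtain ⟨c, hc⟩ := h b
  refine ⟨c, ?_⟩
  rw [hc, Fintype.linearCombination_apply]
  rfl

lemma PowersSpan.exists_derivation_eq {R : Type*} [CommRing R] {ψ : R →+* B} {s : ℕ} {z : B}
    (h : PowersSpan ψ s z) {M : Type*} [AddCommGroup M] [Module B M] (δ : Derivation ℤ B M)
    (hδ : ∀ r, δ (ψ r) = 0) (b : B) : ∃ c : B, δ b = c • δ z := by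
  obtain ⟨c, rfl⟩ := h b
  refine ⟨∑ i : Fin s, ψ (c i) * (((i : ℕ) : B) * z ^ ((i : ℕ) - 1)), ?_⟩
  rw [map_sum, Finset.sum_smul]
  refine Finset.sum_congr rfl fun i _ => ?_
  rw [Derivation.leibniz, hδ, smul_zero, add_zero, Derivation.leibniz_pow,
    ← Nat.cast_smul_eq_nsmul B, smul_smul, smul_smul, mul_assoc]

/-- The powers of `z` still generate after a perturbation which is small enough. -/
lemma PowersSpan.of_sub_mem {I : Ideal B} [IsAdicComplete I B]
    {ψ ψ' : MvPowerSeries (Fin d) k →+* B} {s : ℕ} {z : B} (h : PowersSpan ψ s z)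
    (hmap : (varsIdeal d k).map ψ' = I) (hsub : ∀ r, ψ' r - ψ r ∈ I) : PowersSpan ψ' s z := by
  have : IsHausdorff ((varsIdeal d k).map ψ') B := by
    rw [hmap]
    infer_instance
  refine exists_eq_sum_of_sub_mem (varsIdeal d k) ψ' _ fun b => ?_
  obtain ⟨c, hc⟩ := h b
  refine ⟨c, ?_⟩
  rw [hmap, ← neg_mem_iff]
  nth_rw 1 [hc]
  rw [neg_sub, ← Finset.sum_sub_distrib]
  refine sum_mem fun i _ => ?_
  rw [← sub_mul]
  exact Ideal.mul_mem_right _ _ (hsub _)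

lemma eventually_notMem_sup_span_pow [IsLocalRing B] [IsNoetherianRing B] {z : B}
    (hz : z ∈ IsLocalRing.maximalIdeal B) {Q : Ideal B} {y : B} (hy : y ∉ Q) :
    ∀ᶠ n in atTop, ∀ c, y - z ^ n * c ∉ Q := by
  obtain ⟨n, hn⟩ : ∃ n, y ∉ Q ⊔ Ideal.span {z} ^ n := by
    by_contra! h
    refine hy (mem_of_forall_mem_sup_pow ?_ Q y h)
    intro htop
    rw [Ideal.span_singleton_eq_top] at htop
    exact hz htop
  filter_upwards [eventually_ge_atTop n] with m hm c hc
  refine hn ?_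
  have h1 : z ^ m * c ∈ Ideal.span {z} ^ n := by
    rw [Ideal.span_singleton_pow, Ideal.mem_span_singleton]
    exact (pow_dvd_pow z hm).mul_right c
  have h2 := add_mem (Ideal.mem_sup_left hc) (Ideal.mem_sup_right (S := Q) h1)
  simpa using h2

/-- Let `B` be generated by `z` over the image of `ψ₀`. A perturbation of `ψ₀` makes `z` separable
at finitely many given primes, modulo each of which all finite homomorphisms are injective. The
perturbation for one prime is chosen so small that it keeps `z` separable at the preceding ones. -/
theorem exists_isSepAt (p : ℕ) [Fact p.Prime] [CharP k p] [CharP B p] [IsLocalRing B]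
    [IsNoetherianRing B] {I : Ideal B} (hI : I ≠ ⊤) [IsAdicComplete I B] {z : B} {s : ℕ}
    (hz : z ^ s ∈ I) (ψ₀ : MvPowerSeries (Fin d) k →+* B) (hmap : (varsIdeal d k).map ψ₀ = I)
    (hspan : PowersSpan ψ₀ s z) (S : Finset (Ideal B)) (hS : ∀ Q ∈ S, Q.IsPrime)
    (hinj : ∀ Q ∈ S, ∀ φ : MvPowerSeries (Fin d) k →+* B, φ.Finite → Q.comap φ = ⊥) :
    ∃ ψ : MvPowerSeries (Fin d) k →+* B, (varsIdeal d k).map ψ = I ∧ PowersSpan ψ s z ∧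
      (∀ r, ψ r - ψ₀ r ∈ I) ∧ ∀ Q ∈ S, IsSepAt ψ z Q := by
  classical
  have hp : p.Prime := Fact.out
  have : IsDomain (MvPowerSeries (Fin d) k) := NoZeroDivisors.to_isDomain _
  have hzm : z ∈ IsLocalRing.maximalIdeal B :=
    Ideal.IsPrime.mem_of_pow_mem inferInstance s (IsLocalRing.le_maximalIdeal hI hz)
  induction S using Finset.induction_on with
  | empty => exact ⟨ψ₀, hmap, hspan, fun r => by simp, by simp⟩
  | insert Q S hQS ih =>
    obtain ⟨ψ, hψmap, hψspan, hψsub, hψsep⟩ := ih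
      (fun Q' hQ' => hS Q' (Finset.mem_insert_of_mem hQ'))
      (fun Q' hQ' => hinj Q' (Finset.mem_insert_of_mem hQ'))
    by_cases hQ : IsSepAt ψ z Q
    · refine ⟨ψ, hψmap, hψspan, hψsub, fun Q' hQ' => ?_⟩
      rcases Finset.mem_insert.mp hQ' with rfl | hQ'
      · exact hQ
      · exact hψsep Q' hQ'
    have hQp : Q.IsPrime := hS Q (Finset.mem_insert_self _ _)
    obtain ⟨D, e, f, hfz, hf', hfD⟩ := exists_derivEval_notMem_of_not_isSepAt p ψ hψspan.finite Q
      (hinj Q (Finset.mem_insert_self _ _) ψ hψspan.finite) hQ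
    have hzQ : z ∉ Q := fun h => hQ ⟨Polynomial.X, by simpa using h, by
      simpa using (Ideal.ne_top_iff_one Q).mp hQp.ne_top⟩
    -- The perturbation has size `z ^ (n + 1)`. Here `n` is large, and divisible by `p`, so that the
    -- factor `n + 1` which comes from differentiating `z ^ (n + 1)` is `1`.
    have hev : ∀ᶠ n in atTop, s ≤ n ∧
        (∀ c, f.derivEval ψ (coeffDerivation D e : _ →+ _) z - z ^ n * c ∉ Q) ∧
        ∀ Q' ∈ S, ∃ g : Polynomial (MvPowerSeries (Fin d) k), g.eval₂ ψ z ∈ Q' ∧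
          ∀ c, g.derivative.eval₂ ψ z - z ^ n * c ∉ Q' := by
      refine (eventually_ge_atTop s).and ((eventually_notMem_sup_span_pow hzm hfD).and ?_)
      rw [Filter.eventually_all_finset]
      intro Q' hQ'
      obtain ⟨g, hg, hg'⟩ := hψsep Q' hQ'
      filter_upwards [eventually_notMem_sup_span_pow hzm hg'] with n hn
      exact ⟨g, hg, hn⟩
    obtain ⟨N, hN⟩ := eventually_atTop.mp hev
    obtain ⟨hsn, hn1, hn2⟩ := hN (p * N) (Nat.le_mul_of_pos_left N hp.pos)
    set n := p * N with hn
    have hcast : ((n + 1 : ℕ) : B) = 1 := by simp [hn]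
    have hw : z ^ (n + 1) ∈ I := by
      have : z ^ (n + 1) = z ^ s * z ^ (n + 1 - s) := by
        rw [← pow_add]
        congr 1
        omega
      rw [this]
      exact Ideal.mul_mem_right _ _ hz
    have hψX : ∀ j, ψ (MvPowerSeries.X j) ∈ I := fun j => by
      rw [← hψmap]
      exact Ideal.mem_map_of_mem _ (Ideal.subset_span ⟨j, rfl⟩)
    obtain ⟨ψ', hX, hψ'⟩ := exists_perturbation p hI ψ hψX D e hw
    have hsub : ∀ r, ψ' r - ψ r ∈ I := by
      intro r
      obtain ⟨b, hb⟩ := hψ' r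
      rw [hb, add_assoc, add_sub_cancel_left]
      exact add_mem (Ideal.mul_mem_right _ _ hw)
        (Ideal.mul_mem_right _ _ (Ideal.pow_mem_of_mem I hw 2 two_pos))
    have hmap' : (varsIdeal d k).map ψ' = I := by
      rw [← hψmap, Ideal.map_span, Ideal.map_span, ← Set.range_comp, ← Set.range_comp]
      refine le_antisymm (Ideal.span_le.mpr ?_) (Ideal.span_le.mpr ?_)
      · rintro _ ⟨j, rfl⟩
        change ψ' (MvPowerSeries.X j) ∈ _
        rw [hX]
        exact Ideal.mul_mem_right _ _ (Ideal.subset_span ⟨j, rfl⟩)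
      · rintro _ ⟨j, rfl⟩
        have hunit : IsUnit (1 + z ^ (n + 1) * ψ (MvPowerSeries.C (e j))) := by
          by_contra h
          have h1 := (IsLocalRing.mem_maximalIdeal _).mpr h
          have h2 := IsLocalRing.le_maximalIdeal hI (Ideal.mul_mem_right
            (ψ (MvPowerSeries.C (e j))) I hw)
          exact (Ideal.ne_top_iff_one _).mp (IsLocalRing.maximalIdeal.isMaximal B).ne_top
            (by simpa using sub_mem h1 h2)
        refine (Ideal.mul_unit_mem_iff_mem _ hunit).mp ?_
        change ψ (MvPowerSeries.X j) * _ ∈ _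
        rw [← hX]
        exact Ideal.subset_span ⟨j, rfl⟩
    have hspan' : PowersSpan ψ' s z := hψspan.of_sub_mem hmap' hsub
    -- for a generic derivation `δ` which kills the image of `ψ'`, the relation `g(z) ∈ Q'` gives a
    -- multiple of `δ z` which vanishes; the coefficient is `g'(z)` up to a multiple of `z ^ n`, and
    -- for `g' = 0` it is `z ^ n` times a value which is not in `Q'`
    have key : ∀ Q' ∈ insert Q S, ∀ g : Polynomial (MvPowerSeries (Fin d) k), g.eval₂ ψ z ∈ Q' →
        (∀ c, g.derivative.eval₂ ψ z -
          z ^ n * (g.derivEval ψ (coeffDerivation D e : _ →+ _) z - z ^ (n + 1) * c) ∉ Q') →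
        IsSepAt ψ' z Q' := by
      intro Q' hQ' g hg hgc
      have hQ'p := hS Q' hQ'
      refine isSepAt_of_derivation_eq_zero ψ' hspan'.finite Q' (hinj Q' hQ' ψ' hspan'.finite)
        (fun M _ _ δ hδQ hδ b => ?_) z
      obtain ⟨c, hc⟩ := δ.exists_map_eval₂_eq (D := (coeffDerivation D e : _ →+ _)) hψ' hδ
        (hspan'.exists_derivation_eq δ hδ) g
      rw [hδQ.map_eq_zero _ hg, hcast, one_mul] at hc
      have hδz : δ z = 0 := by
        refine hδQ.eq_zero_of_smul _ (hgc c) _ ?_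
        rw [hc]
        congr 1
        ring
      obtain ⟨c, hc⟩ := hspan'.exists_derivation_eq δ hδ b
      rw [hc, hδz, smul_zero]
    refine ⟨ψ', hmap', hspan', fun r => ?_, fun Q' hQ' => ?_⟩
    · simpa using add_mem (hsub r) (hψsub r)
    · rcases Finset.mem_insert.mp hQ' with rfl | hQ'
      · refine key _ (Finset.mem_insert_self _ _) f hfz fun c hc => ?_
        rw [hf', Polynomial.eval₂_zero, zero_sub, neg_mem_iff] at hc
        rcases hQp.mem_or_mem hc with h | h
        · exact hzQ (hQp.mem_of_pow_mem _ h)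
        · refine hn1 (z * c) ?_
          convert h using 1
          ring
      · obtain ⟨g, hg, hgc⟩ := hn2 Q' hQ'
        exact key _ (Finset.mem_insert_of_mem hQ') g hg fun c => hgc _

end Monogenic

/-! ### Making all generators separable -/

section Generators

universe u

variable {d : ℕ} {k : Type*} [Field k] {A : Type u} [CommRing A]

lemma map_maximalIdeal_le_of_finite {R B : Type*} [CommRing R] [IsLocalRing R] [CommRing B]
    [IsLocalRing B] [Algebra R B] [Module.Finite R B] :
    (IsLocalRing.maximalIdeal R).map (algebraMap R B) ≤ IsLocalRing.maximalIdeal B := by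
  rw [Ideal.map_le_iff_le_comap]
  have := Ideal.isMaximal_comap_of_isIntegral_of_isMaximal (R := R) (IsLocalRing.maximalIdeal B)
  exact (IsLocalRing.eq_maximalIdeal this).ge

lemma exists_pow_mem_map_maximalIdeal {R B : Type*} [CommRing R] [IsLocalRing R] [CommRing B]
    [IsLocalRing B] [Algebra R B] [Module.Finite R B] {z : B}
    (hz : z ∈ IsLocalRing.maximalIdeal B) :
    ∃ s, z ^ s ∈ (IsLocalRing.maximalIdeal R).map (algebraMap R B) := by
  change z ∈ Ideal.radical _
  rw [Ideal.radical_eq_sInf, Ideal.mem_sInf]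
  rintro Q ⟨hQ, hQp⟩
  have h1 : Q.comap (algebraMap R B) = IsLocalRing.maximalIdeal R := by
    refine ((IsLocalRing.maximalIdeal.isMaximal R).eq_of_le ?_
      (Ideal.map_le_iff_le_comap.mp hQ)).symm
    exact (hQp.comap _).ne_top
  have h2 : Q.IsMaximal := Ideal.isMaximal_of_isIntegral_of_isMaximal_comap (R := R) Q
    (by rw [h1]; infer_instance)
  rwa [IsLocalRing.eq_maximalIdeal h2]

lemma powersSpan_of_adjoin_eq_top {R B : Type*} [CommRing R] [CommRing B] (J : Ideal R)
    [IsPrecomplete J R] [Algebra R B] [IsHausdorff (J.map (algebraMap R B)) B] {z : B} {s : ℕ}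
    (hz : z ^ s ∈ J.map (algebraMap R B)) (h : Algebra.adjoin R {z} = ⊤) :
    PowersSpan (algebraMap R B) s z := by
  classical
  refine exists_eq_sum_of_sub_mem J (algebraMap R B) _ fun b => ?_
  have hb : b ∈ Algebra.adjoin R {z} := by rw [h]; trivial
  rw [Algebra.adjoin_singleton_eq_range_aeval] at hb
  obtain ⟨q, rfl⟩ := hb
  change ∃ c : Fin s → R, Polynomial.aeval z q - _ ∈ _
  induction q using Polynomial.induction_on' with
  | add f g hf hg =>
    obtain ⟨c₁, hc₁⟩ := hf
    obtain ⟨c₂, hc₂⟩ := hg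
    refine ⟨c₁ + c₂, ?_⟩
    have h1 := add_mem hc₁ hc₂
    rw [← add_sub_add_comm, ← Finset.sum_add_distrib] at h1
    simpa [add_mul] using h1
  | monomial j a =>
    rw [Polynomial.aeval_monomial]
    by_cases hj : j < s
    · refine ⟨Pi.single ⟨j, hj⟩ a, ?_⟩
      rw [Finset.sum_eq_single ⟨j, hj⟩]
      · simp
      · intro i _ hi
        simp [hi]
      · simp
    · refine ⟨0, ?_⟩
      have : z ^ j = z ^ s * z ^ (j - s) := by
        rw [← pow_add]
        congr 1
        omega
      simp only [Pi.zero_apply, map_zero, zero_mul, Finset.sum_const_zero, sub_zero]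
      rw [this]
      exact Ideal.mul_mem_left _ _ (Ideal.mul_mem_right _ _ hz)

/-- A perturbation of `ψ` makes a given element `z` of the maximal ideal separable at all minimal
primes. It takes place in the subalgebra `B` generated by `z` over the image of `ψ`, which is again
a complete noetherian local ring, and is spanned by finitely many powers of `z` over all small
perturbations of `ψ`. The latter is why the generic derivations which kill the image of the new
homomorphism kill `B`, hence the image of `ψ`. -/
lemma exists_perturbation_of_mem_maximalIdeal (p : ℕ) [Fact p.Prime] [CharP k p] [CharP A p]
    [IsLocalRing A] [IsNoetherianRing A] (ψ : MvPowerSeries (Fin d) k →+* A) (hψ : ψ.Finite)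
    (hinj : ∀ P ∈ minimalPrimes A, ∀ φ : MvPowerSeries (Fin d) k →+* A, φ.Finite → P.comap φ = ⊥)
    {z : A} (hz : z ∈ IsLocalRing.maximalIdeal A) :
    ∃ ψ' : MvPowerSeries (Fin d) k →+* A, ψ'.Finite ∧
      (∀ r, ψ' r - ψ r ∈ IsLocalRing.maximalIdeal A) ∧
      ∀ P ∈ minimalPrimes A, ∀ (M : Type u) [AddCommGroup M] [Module A M] (δ : Derivation ℤ A M),
        δ.IsGenericAt P → (∀ r, δ (ψ' r) = 0) → (∀ r, δ (ψ r) = 0) ∧ δ z = 0 := by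
  classical
  let R := MvPowerSeries (Fin d) k
  let _ : Algebra R A := ψ.toAlgebra
  have : Module.Finite R A := hψ
  have : IsNoetherian R A := isNoetherian_of_isNoetherianRing_of_finite R A
  let B : Subalgebra R A := Algebra.adjoin R {z}
  have hBfin : Module.Finite R B := inferInstanceAs (Module.Finite R (Subalgebra.toSubmodule B))
  have : IsNoetherianRing B := IsNoetherianRing.of_finite R B
  have : Module.Finite B A := Module.Finite.of_restrictScalars_finite R B A
  have : IsLocalHom (algebraMap B A) := (algebraMap_isIntegral_iff.mpr inferInstance).isLocalHom
    Subtype.val_injective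
  have : IsLocalRing B := RingHom.domain_isLocalRing (algebraMap B A)
  have : CharP B p := ((algebraMap B A).charP_iff Subtype.val_injective p).mpr inferInstance
  have hmax : IsLocalRing.maximalIdeal R = varsIdeal d k := maximalIdeal_eq_varsIdeal
  have : IsAdicComplete (IsLocalRing.maximalIdeal R) R := by
    rw [hmax]
    infer_instance
  let I : Ideal B := (IsLocalRing.maximalIdeal R).map (algebraMap R B)
  have hI : I ≠ ⊤ := fun h => (IsLocalRing.maximalIdeal.isMaximal B).ne_top
    (top_le_iff.mp (h ▸ map_maximalIdeal_le_of_finite))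
  have : IsAdicComplete I B := isAdicComplete_map_of_finite B
  let z' : B := ⟨z, Algebra.self_mem_adjoin_singleton R z⟩
  have hz' : z' ∈ IsLocalRing.maximalIdeal B := by
    rw [IsLocalRing.mem_maximalIdeal, mem_nonunits_iff]
    exact fun h => hz (h.map (algebraMap B A))
  obtain ⟨s, hs⟩ := exists_pow_mem_map_maximalIdeal (R := R) hz'
  have hspan : PowersSpan (algebraMap R B) s z' := by
    refine powersSpan_of_adjoin_eq_top (IsLocalRing.maximalIdeal R) hs ?_
    have h1 : Algebra.adjoin R ((Subtype.val : B → A) ⁻¹' {z}) = ⊤ :=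
      Algebra.adjoin_adjoin_coe_preimage
    rw [← h1]
    congr 1
    ext w
    exact Subtype.ext_iff
  have hfin := minimalPrimes.finite_of_isNoetherianRing A
  obtain ⟨ψ', -, hspan', hsub, hsep⟩ := exists_isSepAt p hI hs (algebraMap R B)
    (by rw [← hmax]) hspan (hfin.toFinset.image (Ideal.comap (algebraMap B A)))
    (by
      intro Q hQ
      obtain ⟨P, hP, rfl⟩ := Finset.mem_image.mp hQ
      have : P.IsPrime := (hfin.mem_toFinset.mp hP).1.1
      infer_instance)
    (by
      intro Q hQ φ hφ
      obtain ⟨P, hP, rfl⟩ := Finset.mem_image.mp hQ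
      have h1 : (algebraMap B A).Finite := RingHom.finite_algebraMap.mpr inferInstance
      exact hinj P (hfin.mem_toFinset.mp hP) ((algebraMap B A).comp φ) (h1.comp hφ))
  have h1 : (algebraMap B A).Finite := RingHom.finite_algebraMap.mpr inferInstance
  refine ⟨(algebraMap B A).comp ψ', h1.comp hspan'.finite, fun r => ?_,
    fun P hP M _ _ δ hδP hδ => ?_⟩
  · have h2 := IsLocalRing.le_maximalIdeal hI (hsub r)
    rw [IsLocalRing.mem_maximalIdeal, mem_nonunits_iff] at h2 ⊢
    intro h3
    exact h2 (isUnit_of_map_unit (algebraMap B A) _ (by rw [map_sub]; exact h3))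
  · let δ' : Derivation ℤ B M := δ.compAlgebraMap B
    have hδ' : ∀ b : B, δ' b = δ b := fun b => rfl
    have hgen : δ'.IsGenericAt (P.comap (algebraMap B A)) :=
      ⟨fun x hx => hδP.map_eq_zero _ hx, fun b hb m hm => hδP.eq_zero_of_smul _ hb m hm⟩
    have hsepP := hsep _ (Finset.mem_image_of_mem _ (hfin.mem_toFinset.mpr hP))
    have hδz : δ' z' = 0 := hsepP.derivation_eq_zero hgen hδ
    refine ⟨fun r => ?_, hδz⟩
    obtain ⟨c, hc⟩ := hspan'.exists_derivation_eq δ' hδ (algebraMap R B r)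
    rw [hδz, smul_zero] at hc
    exact hc

/-- Successive perturbations, one for each generator: a generic derivation which kills the image of
the last homomorphism kills the images of all the preceding ones and all the generators. -/
theorem exists_perturbation_of_subset_maximalIdeal (p : ℕ) [Fact p.Prime] [CharP k p] [CharP A p]
    [IsLocalRing A] [IsNoetherianRing A] (ψ : MvPowerSeries (Fin d) k →+* A) (hψ : ψ.Finite)
    (hinj : ∀ P ∈ minimalPrimes A, ∀ φ : MvPowerSeries (Fin d) k →+* A, φ.Finite → P.comap φ = ⊥)
    (T : Finset A) (hT : ∀ z ∈ T, z ∈ IsLocalRing.maximalIdeal A) :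
    ∃ ψ' : MvPowerSeries (Fin d) k →+* A, ψ'.Finite ∧
      (∀ r, ψ' r - ψ r ∈ IsLocalRing.maximalIdeal A) ∧
      ∀ P ∈ minimalPrimes A, ∀ (M : Type u) [AddCommGroup M] [Module A M] (δ : Derivation ℤ A M),
        δ.IsGenericAt P → (∀ r, δ (ψ' r) = 0) → (∀ r, δ (ψ r) = 0) ∧ ∀ z ∈ T, δ z = 0 := by
  classical
  induction T using Finset.induction_on with
  | empty => exact ⟨ψ, hψ, by simp, fun P _ M _ _ δ _ h => ⟨h, by simp⟩⟩
  | insert z T _ ih =>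
    obtain ⟨ψ₁, hfin₁, hsub₁, hδ₁⟩ := ih fun w hw => hT w (Finset.mem_insert_of_mem hw)
    obtain ⟨ψ₂, hfin₂, hsub₂, hδ₂⟩ := exists_perturbation_of_mem_maximalIdeal p ψ₁ hfin₁ hinj
      (hT z (Finset.mem_insert_self _ _))
    refine ⟨ψ₂, hfin₂, fun r => by simpa using add_mem (hsub₂ r) (hsub₁ r),
      fun P hP M _ _ δ hδP hδ => ?_⟩
    obtain ⟨h1, h2⟩ := hδ₂ P hP M δ hδP hδ
    obtain ⟨h3, h4⟩ := hδ₁ P hP M δ hδP h1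
    refine ⟨h3, fun w hw => ?_⟩
    rcases Finset.mem_insert.mp hw with rfl | hw
    · exact h2
    · exact h4 w hw

end Generators

/-! ### Dimension, coefficient fields and systems of parameters -/

section Dimension

variable {d : ℕ}

lemma ringKrullDim_le_of_forall_minimalPrimes {A : Type*} [CommRing A] {n : WithBot ℕ∞}
    (h : ∀ P ∈ minimalPrimes A, ringKrullDim (A ⧸ P) ≤ n) : ringKrullDim A ≤ n := by
  refine iSup_le fun l => ?_
  obtain ⟨P, hP, hPl⟩ := Ideal.exists_minimalPrimes_le (J := l.head.asIdeal) bot_le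
  refine le_trans ?_ (h P hP)
  rw [ringKrullDim_quotient]
  let l' : LTSeries (PrimeSpectrum.zeroLocus (R := A) P) :=
    { length := l.length
      toFun := fun i => ⟨l i, hPl.trans (l.monotone (Fin.zero_le i))⟩
      step := fun i => l.step i }
  exact Order.LTSeries.length_le_krullDim l'

/-- By incomparability, distinct primes in a chain contract to distinct primes. -/
lemma ringKrullDim_le_of_isIntegral {R S : Type*} [CommRing R] [CommRing S] [Algebra R S]
    [Algebra.IsIntegral R S] : ringKrullDim S ≤ ringKrullDim R :=
  Order.krullDim_le_of_strictMono (PrimeSpectrum.comap (algebraMap R S)) fun _ _ h =>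
    Ideal.IsIntegral.comap_lt_comap h

lemma ringKrullDim_mvPowerSeries_le (d : ℕ) (k : Type*) [Field k] :
    ringKrullDim (MvPowerSeries (Fin d) k) ≤ d := by
  rw [← IsLocalRing.maximalIdeal_height_eq_ringKrullDim, maximalIdeal_eq_varsIdeal]
  have hmin : varsIdeal d k ∈ (varsIdeal d k).minimalPrimes := by
    have : (varsIdeal d k).IsPrime := by
      rw [← maximalIdeal_eq_varsIdeal]
      infer_instance
    rw [Ideal.minimalPrimes_eq_subsingleton_self]
    rfl
  have h1 := Ideal.height_le_card_of_mem_minimalPrimes_span (Set.finite_range _) hmin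
  have h2 : (Set.range (MvPowerSeries.X : Fin d → MvPowerSeries (Fin d) k)).ncard ≤ d := by
    rw [← Set.image_univ]
    refine (Set.ncard_image_le Set.finite_univ).trans ?_
    simp
  exact_mod_cast h1.trans (by exact_mod_cast h2)

/-- If the kernel modulo `P` were nonzero, `A ⧸ P` would be integral over a proper quotient of the
domain `k⟦t₁, …, t_d⟧`, and its dimension would be less than `d`. -/
lemma comap_eq_bot_of_ringKrullDim_eq {A k : Type*} [CommRing A] [Field k] {P : Ideal A}
    (hP : ringKrullDim (A ⧸ P) = d) (φ : MvPowerSeries (Fin d) k →+* A) (hφ : φ.Finite) :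
    P.comap φ = ⊥ := by
  let R := MvPowerSeries (Fin d) k
  rw [eq_bot_iff]
  intro r hr
  by_contra hr0
  have hr1 : r ∈ nonZeroDivisors R := mem_nonZeroDivisors_of_ne_zero hr0
  have h1 := (ringKrullDim_quotient_succ_le_of_nonZeroDivisor hr1).trans
    (ringKrullDim_mvPowerSeries_le d k)
  let g : R →+* A ⧸ P := (Ideal.Quotient.mk P).comp φ
  have hg : g.Finite := (RingHom.Finite.of_surjective _ Ideal.Quotient.mk_surjective).comp hφ
  have hrg : ∀ a ∈ Ideal.span {r}, g a = 0 := by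
    intro a ha
    obtain ⟨b, rfl⟩ := Ideal.mem_span_singleton'.mp ha
    have : g r = 0 := Ideal.Quotient.eq_zero_iff_mem.mpr hr
    rw [map_mul, this, mul_zero]
  let g' : R ⧸ Ideal.span {r} →+* A ⧸ P := Ideal.Quotient.lift _ g hrg
  have hg' : g'.Finite := RingHom.Finite.of_comp_finite (f := Ideal.Quotient.mk (Ideal.span {r}))
    (by rwa [show g'.comp (Ideal.Quotient.mk _) = g from RingHom.ext fun _ => rfl])
  let _ : Algebra (R ⧸ Ideal.span {r}) (A ⧸ P) := g'.toAlgebra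
  have : Module.Finite (R ⧸ Ideal.span {r}) (A ⧸ P) := hg'
  have h2 : ringKrullDim (A ⧸ P) ≤ ringKrullDim (R ⧸ Ideal.span {r}) :=
    ringKrullDim_le_of_isIntegral
  have h3 : ((d : WithBot ℕ∞)) + 1 ≤ d := by
    rw [← hP]
    refine le_trans ?_ (h1.trans_eq hP.symm)
    gcongr
  have h4 : d + 1 ≤ d := by exact_mod_cast h3
  omega

end Dimension

section CoefficientField

open IsLocalRing

variable {d : ℕ} {A : Type*} [CommRing A] [IsLocalRing A]

/-- A complete local ring of characteristic `p` contains a coefficient field, as its residue field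
is formally smooth over the prime field. -/
lemma exists_coefficientField (p : ℕ) [Fact p.Prime] [CharP A p]
    [IsAdicComplete (maximalIdeal A) A] :
    ∃ σ : ResidueField A →+* A, ∀ c, residue A (σ c) = c := by
  let _ : Algebra (ZMod p) A := ZMod.algebra A p
  have := formallySmooth_zmod p (ResidueField A)
  obtain ⟨σ, hσ⟩ := Algebra.FormallySmooth.exists_mkₐ_comp_eq_of_isAdicComplete
    (I := maximalIdeal A) (AlgHom.id (ZMod p) (ResidueField A))
  exact ⟨σ, fun c => congr($hσ c)⟩

/-- A local ring of dimension at most `d` has a system of parameters, filled up with zeros to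
length `d`. -/
lemma exists_pow_le_span_range [IsNoetherianRing A] (h : ringKrullDim A ≤ d) :
    ∃ b : Fin d → A, (∀ j, b j ∈ maximalIdeal A) ∧
      ∃ n, maximalIdeal A ^ n ≤ Ideal.span (Set.range b) := by
  obtain ⟨s, hs, hcard⟩ :=
    (maximalIdeal A).exists_finset_card_eq_height_of_isNoetherianRing
  have hsd : s.card ≤ d := by
    rw [← maximalIdeal_height_eq_ringKrullDim, ← hcard] at h
    exact_mod_cast h
  let b : Fin d → A := fun j => if hj : (j : ℕ) < s.card then s.equivFin.symm ⟨j, hj⟩ else 0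
  have hsm : ∀ x ∈ s, x ∈ maximalIdeal A := fun x hx => hs.1.2 (Ideal.subset_span hx)
  have hsb : Ideal.span (s : Set A) ≤ Ideal.span (Set.range b) := by
    refine Ideal.span_mono fun x hx => ?_
    refine ⟨⟨s.equivFin ⟨x, hx⟩, (Fin.is_lt _).trans_le hsd⟩, ?_⟩
    simp [b]
  refine ⟨b, fun j => ?_, ?_⟩
  · by_cases hj : (j : ℕ) < s.card
    · simpa [b, hj] using hsm _ (s.equivFin.symm ⟨j, hj⟩).2
    · simp [b, hj]
  · have hrad : maximalIdeal A ≤ (Ideal.span (s : Set A)).radical := by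
      rw [Ideal.radical_eq_sInf]
      refine le_sInf fun Q hQ => hs.2 ⟨hQ.2, hQ.1⟩ (le_maximalIdeal hQ.2.ne_top)
    obtain ⟨n, hn⟩ := Ideal.exists_pow_le_of_le_radical_of_fg hrad
      (IsNoetherian.noetherian (maximalIdeal A))
    exact ⟨n, hn.trans hsb⟩

/-- Modulo each power of its maximal ideal, a noetherian local ring is spanned over a coefficient
field by finitely many elements. -/
lemma exists_finset_forall_sub_mem_maximalIdeal_pow [IsNoetherianRing A]
    (σ : ResidueField A →+* A) (hσ : ∀ c, residue A (σ c) = c) (n : ℕ) :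
    ∃ S : Finset A, ∀ a, ∃ c : S → ResidueField A,
      a - ∑ i, σ (c i) * i ∈ maximalIdeal A ^ n := by
  classical
  let _ : Algebra (ResidueField A) A := σ.toAlgebra
  suffices h : ∃ S : Finset A, ∀ a, ∃ v ∈ Submodule.span (ResidueField A) (S : Set A),
      a - v ∈ maximalIdeal A ^ n by
    obtain ⟨S, hS⟩ := h
    refine ⟨S, fun a => ?_⟩
    obtain ⟨v, hv, hav⟩ := hS a
    obtain ⟨c, rfl⟩ := Submodule.mem_span_finset'.mp hv
    exact ⟨c, by simpa [Algebra.smul_def, RingHom.algebraMap_toAlgebra] using hav⟩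
  induction n with
  | zero => exact ⟨∅, fun a => ⟨0, zero_mem _, by simp⟩⟩
  | succ n ih =>
    obtain ⟨S, hS⟩ := ih
    obtain ⟨G, hG⟩ : (maximalIdeal A ^ n).FG := IsNoetherian.noetherian _
    have hstep : ∀ x ∈ Submodule.span A (G : Set A),
        ∃ w ∈ Submodule.span (ResidueField A) (G : Set A), x - w ∈ maximalIdeal A ^ (n + 1) := by
      intro x hx
      induction hx using Submodule.span_induction with
      | mem g hg => exact ⟨g, Submodule.subset_span hg, by simp⟩
      | zero => exact ⟨0, zero_mem _, by simp⟩
      | add x y _ _ hx hy =>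
        obtain ⟨w₁, h₁, h₁'⟩ := hx
        obtain ⟨w₂, h₂, h₂'⟩ := hy
        exact ⟨w₁ + w₂, add_mem h₁ h₂, by simpa [add_sub_add_comm] using add_mem h₁' h₂'⟩
      | smul a x hx ih =>
        obtain ⟨w, hw, hxw⟩ := ih
        have hx' : x ∈ maximalIdeal A ^ n := hG ▸ hx
        refine ⟨residue A a • w, Submodule.smul_mem _ _ hw, ?_⟩
        have hw' : w ∈ maximalIdeal A ^ n := by
          simpa using sub_mem hx' (Ideal.pow_le_pow_right n.le_succ hxw)
        have ha : a - σ (residue A a) ∈ maximalIdeal A := by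
          rw [← residue_eq_zero_iff, map_sub, hσ, sub_self]
        have heq : a • x - residue A a • w = a * (x - w) + (a - σ (residue A a)) * w := by
          rw [smul_eq_mul, Algebra.smul_def, RingHom.algebraMap_toAlgebra]
          ring
        rw [heq]
        refine add_mem (Ideal.mul_mem_left _ _ hxw) ?_
        rw [pow_succ']
        exact Ideal.mul_mem_mul ha hw'
    refine ⟨S ∪ G, fun a => ?_⟩
    obtain ⟨v, hv, hav⟩ := hS a
    obtain ⟨w, hw, haw⟩ := hstep (a - v) (by rw [← Ideal.submodule_span_eq, hG] at *; exact hav)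
    refine ⟨v + w, add_mem (Submodule.span_mono (by simp) hv)
      (Submodule.span_mono (by simp) hw), ?_⟩
    rwa [← sub_sub]

/-- Cohen's structure theorem: a coefficient field and a system of parameters define a finite
homomorphism. -/
theorem exists_finite_ringHom_of_ringKrullDim_le [IsNoetherianRing A] (p : ℕ) [Fact p.Prime]
    [CharP A p] [IsAdicComplete (maximalIdeal A) A] (h : ringKrullDim A ≤ d) :
    ∃ ψ : MvPowerSeries (Fin d) (ResidueField A) →+* A, ψ.Finite ∧
      ∀ c, residue A (ψ (MvPowerSeries.C c)) = c := by
  obtain ⟨σ, hσ⟩ := exists_coefficientField (A := A) p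
  obtain ⟨b, hb, n, hn⟩ := exists_pow_le_span_range h
  obtain ⟨ψ, hψC, hψX⟩ := exists_ringHom_of_isAdicComplete (maximalIdeal A) σ b hb
  refine ⟨ψ, ?_, fun c => by rw [hψC, hσ]⟩
  have hmap : (varsIdeal d (ResidueField A)).map ψ = Ideal.span (Set.range b) := by
    rw [Ideal.map_span, ← Set.range_comp]
    congr 2
    exact funext hψX
  have hle : Ideal.span (Set.range b) ≤ maximalIdeal A := by
    rw [Ideal.span_le]
    rintro _ ⟨j, rfl⟩
    exact hb j
  have : IsHausdorff ((varsIdeal d (ResidueField A)).map ψ) A := by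
    rw [hmap]
    have htop : Ideal.span (Set.range b) ≠ ⊤ := fun htop =>
      (maximalIdeal.isMaximal A).ne_top (top_le_iff.mp (htop ▸ hle))
    exact IsHausdorff.of_isLocalRing _ _ htop
  obtain ⟨S, hS⟩ := exists_finset_forall_sub_mem_maximalIdeal_pow σ hσ n
  have hspan := exists_eq_sum_of_sub_mem (varsIdeal d (ResidueField A)) ψ
    (fun i : S => (i : A)) fun a => by
      obtain ⟨c, hc⟩ := hS a
      refine ⟨fun i => MvPowerSeries.C (c i), ?_⟩
      simp only [hψC]
      rw [hmap]
      exact hn hc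
  let _ := ψ.toAlgebra
  refine Module.Finite.of_surjective
    (Fintype.linearCombination (MvPowerSeries (Fin d) (ResidueField A)) fun i : S => (i : A))
    fun a => ?_
  obtain ⟨c, hc⟩ := hspan a
  refine ⟨c, ?_⟩
  rw [hc, Fintype.linearCombination_apply]
  rfl

end CoefficientField

/-! ### Generic étaleness -/

section GenericallyEtale

lemma dense_basicOpen_of_forall_minimalPrimes {A : Type*} [CommRing A] {f : A}
    (h : ∀ P ∈ minimalPrimes A, f ∉ P) :
    Dense (PrimeSpectrum.basicOpen f : Set (PrimeSpectrum A)) := by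
  intro x
  obtain ⟨P, hP, hPx⟩ := Ideal.exists_minimalPrimes_le (J := x.asIdeal) bot_le
  let y : PrimeSpectrum A := ⟨P, hP.1.1⟩
  have hyx : y ⤳ x := (PrimeSpectrum.le_iff_specializes y x).mp hPx
  exact hyx.mem_closed isClosed_closure (subset_closure (show f ∉ P from h P hP))

lemma isField_localization_atPrime {A : Type*} [CommRing A] [IsReduced A] {P : Ideal A}
    [P.IsPrime] (hP : P ∈ minimalPrimes A) : IsField (Localization.AtPrime P) := by
  have : Ring.KrullDimLE 0 (Localization.AtPrime P) := .of_isLocalization _ hP _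
  exact Ring.KrullDimLE.isField_of_isReduced

/-- The universal derivation of `A_P` over `R` is generic at `P`, so that it vanishes if all generic
derivations which kill `R` vanish. -/
lemma formallyUnramified_localization_atPrime.{u} {A : Type u} [CommRing A] [IsReduced A]
    {R : Type u} [CommRing R] [Algebra R A] {P : Ideal A} [P.IsPrime] (hP : P ∈ minimalPrimes A)
    (h : ∀ (M : Type u) [AddCommGroup M] [Module A M] (δ : Derivation ℤ A M),
      δ.IsGenericAt P → (∀ r, δ (algebraMap R A r) = 0) → ∀ a, δ a = 0) :
    Algebra.FormallyUnramified R (Localization.AtPrime P) := by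
  let F := Localization.AtPrime P
  let _ : Field F := (isField_localization_atPrime hP).toField
  let δ : Derivation ℤ A Ω[F⁄R] := ((KaehlerDifferential.D R F).compAlgebraMap A).restrictScalars ℤ
  have hδ : ∀ a, δ a = KaehlerDifferential.D R F (algebraMap A F a) := fun _ => rfl
  have hunit : ∀ b ∉ P, IsUnit (algebraMap A F b) := fun b hb =>
    IsLocalization.map_units F (⟨b, hb⟩ : P.primeCompl)
  have hsmul : ∀ b ∉ P, ∀ m : Ω[F⁄R], b • m = 0 → m = 0 := by
    intro b hb m hm
    rw [← algebraMap_smul F] at hm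
    exact ((hunit b hb).smul_eq_zero).mp hm
  have hgen : δ.IsGenericAt P := by
    refine ⟨fun x hx => ?_, hsmul⟩
    have hx0 : algebraMap A F x = 0 := by
      by_contra hne
      exact (IsLocalization.AtPrime.isUnit_to_map_iff F P x).mp (Ne.isUnit hne) hx
    rw [hδ, hx0, map_zero]
  have hzero := h _ δ hgen fun r => by
    rw [hδ, ← IsScalarTower.algebraMap_apply R A F, Derivation.map_algebraMap]
  constructor
  rw [← Submodule.subsingleton_iff F, ← subsingleton_iff_bot_eq_top,
    ← KaehlerDifferential.span_range_derivation, eq_comm, Submodule.span_eq_bot]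
  rintro _ ⟨x, rfl⟩
  obtain ⟨a, s, rfl⟩ := IsLocalization.exists_mk'_eq P.primeCompl x
  refine hsmul s s.2 _ ?_
  have h1 := hzero a
  rw [hδ, ← IsLocalization.mk'_spec F a s, Derivation.leibniz, ← hδ, hzero, smul_zero,
    zero_add, algebraMap_smul] at h1
  exact h1

variable {R A : Type*} [CommRing R] [IsDomain R] [CommRing A] [IsReduced A] [Algebra R A]

/-- If `R` injects into the field `A_P` and `A_P` is unramified over `R`, it is étale over the
fraction field of `R`, hence over `R`. -/
lemma formallyEtale_localization_atPrime [Module.Finite R A] {P : Ideal A} [P.IsPrime]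
    (hP : P ∈ minimalPrimes A) (hcomap : P.comap (algebraMap R A) = ⊥)
    [Algebra.FormallyUnramified R (Localization.AtPrime P)] :
    Algebra.FormallyEtale R (Localization.AtPrime P) := by
  let F := Localization.AtPrime P
  let _ : Field F := (isField_localization_atPrime hP).toField
  have hinj : Function.Injective (algebraMap R F) := by
    rw [injective_iff_map_eq_zero]
    intro r hr
    rw [IsScalarTower.algebraMap_apply R A F] at hr
    have h1 : algebraMap R A r ∈ P := by
      by_contra h
      exact (IsLocalization.map_units F (⟨_, h⟩ : P.primeCompl)).ne_zero hr
    have h2 : r ∈ P.comap (algebraMap R A) := h1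
    rwa [hcomap] at h2
  let K := FractionRing R
  have : FaithfulSMul R F := (faithfulSMul_iff_algebraMap_injective R F).mpr hinj
  let _ : Algebra K F := FractionRing.liftAlgebra R F
  have : IsScalarTower R K F := FractionRing.isScalarTower_liftAlgebra R F
  have : Algebra.FormallyUnramified K F := .of_restrictScalars R K F
  have : Algebra.EssFiniteType A F := Algebra.EssFiniteType.of_isLocalization F P.primeCompl
  have : Algebra.EssFiniteType R F := Algebra.EssFiniteType.comp R A F
  have : Algebra.EssFiniteType K F := Algebra.EssFiniteType.of_comp R K F
  have : Algebra.FormallyEtale K F := Algebra.FormallyEtale.of_formallyUnramified_of_field K F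
  have : Algebra.FormallyEtale R K := Algebra.FormallyEtale.of_isLocalization (nonZeroDivisors R)
  exact Algebra.FormallyEtale.comp R K F

/-- The complement of the étale locus has a closed image in `Spec R`, as `A` is integral over `R`.
The fibre over the generic point consists of the minimal primes, where `A` is étale over `R`, so
that this image is a proper closed subset. -/
theorem isGenericallyEtale_of_formallyUnramified [IsNoetherianRing R] [Module.Finite R A]
    (hcomap : ∀ P ∈ minimalPrimes A, P.comap (algebraMap R A) = ⊥)
    (h : ∀ (P : Ideal A) [P.IsPrime], P ∈ minimalPrimes A →
      Algebra.FormallyUnramified R (Localization.AtPrime P)) :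
    IsGenericallyEtale R A := by
  have : Algebra.FinitePresentation R A :=
    Algebra.FinitePresentation.of_finiteType.mp inferInstance
  let Z : Set (PrimeSpectrum A) := (Algebra.etaleLocus R A)ᶜ
  have hZ : IsClosed (PrimeSpectrum.comap (algebraMap R A) '' Z) :=
    PrimeSpectrum.isClosedMap_comap_of_isIntegral _ (algebraMap_isIntegral_iff.mpr inferInstance) _
      Algebra.isOpen_etaleLocus.isClosed_compl
  let η : PrimeSpectrum R := ⟨⊥, Ideal.isPrime_bot⟩
  have hη : η ∈ (PrimeSpectrum.comap (algebraMap R A) '' Z)ᶜ := by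
    rintro ⟨Q, hQ, hQη⟩
    obtain ⟨P, hP, hPQ⟩ := Ideal.exists_minimalPrimes_le (J := Q.asIdeal) bot_le
    have : P.IsPrime := hP.1.1
    have hQ' : Q.asIdeal.comap (algebraMap R A) = ⊥ := congr_arg PrimeSpectrum.asIdeal hQη
    obtain rfl | hlt := hPQ.eq_or_lt
    · exact hQ (have := h _ hP; formallyEtale_localization_atPrime hP hQ')
    · have := Ideal.IsIntegral.comap_lt_comap (R := R) hlt
      rw [hcomap P hP, hQ'] at this
      exact this.false
  obtain ⟨_, ⟨_, ⟨f, rfl⟩, rfl⟩, hfη, hf⟩ :=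
    PrimeSpectrum.isBasis_basic_opens.exists_subset_of_mem_open hη hZ.isOpen_compl
  have hf0 : f ≠ 0 := fun h0 => hfη (by rw [h0]; exact Ideal.zero_mem _)
  refine ⟨f, dense_basicOpen_of_forall_minimalPrimes fun P hP hfP => ?_,
    dense_basicOpen_of_forall_minimalPrimes fun P hP hfP => ?_, ?_⟩
  · rw [IsDomain.minimalPrimes_eq_singleton_bot, Set.mem_singleton_iff] at hP
    rw [hP] at hfP
    exact hf0 hfP
  · have h1 : f ∈ P.comap (algebraMap R A) := hfP
    rw [hcomap P hP] at h1
    exact hf0 h1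
  · rw [← Algebra.basicOpen_subset_etaleLocus_iff_etale]
    intro Q hQ
    by_contra hQZ
    exact hf (show PrimeSpectrum.comap (algebraMap R A) Q ∈ PrimeSpectrum.basicOpen f from hQ)
      ⟨Q, hQZ, rfl⟩

end GenericallyEtale

/-! ### The Cohen–Gabber homomorphism -/

section Main

lemma mem_nonZeroDivisors_of_forall_minimalPrimes {A : Type*} [CommRing A] [IsReduced A] {a : A}
    (h : ∀ P ∈ minimalPrimes A, a ∉ P) : a ∈ nonZeroDivisors A := by
  rw [mem_nonZeroDivisors_iff_right]
  intro b hb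
  have : b ∈ sInf (minimalPrimes A) := by
    rw [Ideal.mem_sInf]
    intro P hP
    have := hP.1.1
    exact (this.mem_or_mem (by rw [hb]; exact P.zero_mem)).resolve_right (h P hP)
  rw [show minimalPrimes A = (⊥ : Ideal A).minimalPrimes from rfl, Ideal.sInf_minimalPrimes] at this
  obtain ⟨n, hn⟩ := this
  exact IsReduced.eq_zero b ⟨n, hn⟩

open IsLocalRing in
/-- There is a finite homomorphism from the power series ring over the residue field such that the
derivations which are generic at a minimal prime vanish if they kill its image. A first finite
homomorphism is perturbed so as to make finitely many module generators separable; these are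
translated by constants into the maximal ideal beforehand. -/
theorem exists_finite_ringHom_forall_isGenericAt.{u} {A : Type u} [CommRing A] [IsLocalRing A]
    [IsNoetherianRing A] [IsAdicComplete (maximalIdeal A) A]
    (p : ℕ) [Fact p.Prime] [CharP A p] (d : ℕ) (hd : IsEquidimensionalOfDim A d) :
    ∃ ψ : MvPowerSeries (Fin d) (ResidueField A) →+* A, ψ.Finite ∧
      (∀ c, residue A (ψ (MvPowerSeries.C c)) = c) ∧
      ∀ P ∈ minimalPrimes A, ∀ (M : Type u) [AddCommGroup M] [Module A M] (δ : Derivation ℤ A M),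
        δ.IsGenericAt P → (∀ r, δ (ψ r) = 0) → ∀ a, δ a = 0 := by
  classical
  have hdim : ringKrullDim A ≤ d := ringKrullDim_le_of_forall_minimalPrimes fun P hP => (hd P hP).le
  obtain ⟨ψ, hψ, hres⟩ := exists_finite_ringHom_of_ringKrullDim_le p hdim
  have hinj : ∀ P ∈ minimalPrimes A, ∀ φ : MvPowerSeries (Fin d) (ResidueField A) →+* A,
      φ.Finite → P.comap φ = ⊥ := fun P hP φ hφ =>
    comap_eq_bot_of_ringKrullDim_eq (hd P hP) φ hφ
  have : CharP (ResidueField A) p :=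
    ((ψ.comp MvPowerSeries.C).charP_iff (ψ.comp MvPowerSeries.C).injective p).mpr inferInstance
  let _ : Algebra (MvPowerSeries (Fin d) (ResidueField A)) A := ψ.toAlgebra
  have : Module.Finite (MvPowerSeries (Fin d) (ResidueField A)) A := hψ
  obtain ⟨S, hS⟩ := (Module.Finite.fg_top :
    (⊤ : Submodule (MvPowerSeries (Fin d) (ResidueField A)) A).FG)
  let τ : A → A := fun g => g - ψ (MvPowerSeries.C (residue A g))
  have hτ : ∀ z ∈ S.image τ, z ∈ maximalIdeal A := by
    intro z hz
    obtain ⟨g, -, rfl⟩ := Finset.mem_image.mp hz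
    rw [← residue_eq_zero_iff, map_sub, hres, sub_self]
  obtain ⟨ψ', hψ', hsub, hδ⟩ := exists_perturbation_of_subset_maximalIdeal p ψ hψ hinj _ hτ
  refine ⟨ψ', hψ', fun c => ?_, fun P hP M _ _ δ hδP hδ0 a => ?_⟩
  · have h1 := (residue_eq_zero_iff _).mpr (hsub (MvPowerSeries.C c))
    rwa [map_sub, hres, sub_eq_zero] at h1
  · obtain ⟨h1, h2⟩ := hδ P hP M δ hδP hδ0
    have ha : a ∈ Submodule.span (MvPowerSeries (Fin d) (ResidueField A)) (S : Set A) := by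
      rw [hS]
      trivial
    induction ha using Submodule.span_induction with
    | mem g hg =>
      have h3 := h2 (τ g) (Finset.mem_image_of_mem τ hg)
      rwa [map_sub, h1, sub_zero] at h3
    | zero => exact map_zero δ
    | add x y _ _ hx hy => rw [map_add, hx, hy, add_zero]
    | smul r x _ hx =>
      rw [Algebra.smul_def, Derivation.leibniz, hx, smul_zero, zero_add]
      rw [RingHom.algebraMap_toAlgebra, h1, smul_zero]

end Main

theorem mainTheorem5 {A : Type*} [CommRing A] [IsLocalRing A] [IsNoetherianRing A] [IsReduced A]
    [IsAdicComplete (IsLocalRing.maximalIdeal A) A]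
    (p : ℕ) [Fact p.Prime] [CharP A p]
    (d : ℕ) (hd : IsEquidimensionalOfDim A d) :
    ∃ (A₀ : Subring A) (_ : IsLocalRing A₀) (_ : IsLocalHom A₀.subtype),
      Nonempty (A₀ ≃+* MvPowerSeries (Fin d) (IsLocalRing.ResidueField A)) ∧
      Module.Finite A₀ A ∧
      Module.IsTorsionFree A₀ A ∧
      IsGenericallyEtale A₀ A ∧
      Function.Bijective (IsLocalRing.ResidueField.map A₀.subtype) := by
  obtain ⟨ψ, hψ, hres, hδ⟩ := exists_finite_ringHom_forall_isGenericAt p d hd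
  have hker : ∀ P ∈ minimalPrimes A, P.comap ψ = ⊥ := fun P hP =>
    comap_eq_bot_of_ringKrullDim_eq (hd P hP) ψ hψ
  have hinj : Function.Injective ψ := by
    rw [injective_iff_map_eq_zero]
    intro r hr
    obtain ⟨P, hP, -⟩ := Ideal.exists_minimalPrimes_le (I := (⊥ : Ideal A))
      (J := IsLocalRing.maximalIdeal A) bot_le
    have h1 : r ∈ P.comap ψ := by
      rw [Ideal.mem_comap, hr]
      exact P.zero_mem
    rwa [hker P hP] at h1
  let e : MvPowerSeries (Fin d) (IsLocalRing.ResidueField A) ≃+* ψ.range :=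
    RingEquiv.ofBijective ψ.rangeRestrict
      ⟨fun x y h => hinj congr(($h : A)), ψ.rangeRestrict_surjective⟩
  have he : ∀ r, (e r : A) = ψ r := fun _ => rfl
  have hloc : IsLocalRing ψ.range := e.isLocalRing
  have : IsDomain (MvPowerSeries (Fin d) (IsLocalRing.ResidueField A)) :=
    NoZeroDivisors.to_isDomain _
  have hdom : IsDomain ψ.range := e.symm.toMulEquiv.isDomain _
  have hnoeth : IsNoetherianRing ψ.range := isNoetherianRing_of_ringEquiv _ e
  have hfin : Module.Finite ψ.range A := by
    have h1 : (algebraMap ψ.range A).Finite :=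
      RingHom.Finite.of_comp_finite (f := e.toRingHom) hψ
    exact RingHom.finite_algebraMap.mp h1
  have hlocal : IsLocalHom ψ.range.subtype :=
    (algebraMap_isIntegral_iff.mpr (inferInstance : Algebra.IsIntegral ψ.range A)).isLocalHom
      Subtype.val_injective
  have hcomap : ∀ P ∈ minimalPrimes A, P.comap (algebraMap ψ.range A) = ⊥ := by
    intro P hP
    rw [eq_bot_iff]
    intro x hx
    obtain ⟨r, rfl⟩ := e.surjective x
    have h1 : r ∈ P.comap ψ := hx
    rw [hker P hP] at h1
    rw [show r = 0 from h1, map_zero]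
    exact zero_mem _
  refine ⟨ψ.range, hloc, hlocal, ⟨e.symm⟩, hfin, ?_, ?_, ?_⟩
  · rw [Module.isTorsionFree_iff_smul_eq_zero]
    intro x a hxa
    by_contra! hne
    have h1 : algebraMap ψ.range A x ∈ nonZeroDivisors A :=
      mem_nonZeroDivisors_of_forall_minimalPrimes fun P hP hxP => by
        have h2 : x ∈ P.comap (algebraMap ψ.range A) := hxP
        rw [hcomap P hP] at h2
        exact hne.1 h2
    rw [Algebra.smul_def] at hxa
    exact hne.2 ((mem_nonZeroDivisors_iff.mp h1).1 _ hxa)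
  · refine isGenericallyEtale_of_formallyUnramified hcomap fun P _ hP =>
      formallyUnramified_localization_atPrime hP fun M _ _ δ hδP h0 a => ?_
    exact hδ P hP M δ hδP (fun r => h0 (e r)) a
  · refine ⟨(IsLocalRing.ResidueField.map ψ.range.subtype).injective, fun c => ?_⟩
    exact ⟨IsLocalRing.residue _ (e (MvPowerSeries.C c)), by
      rw [IsLocalRing.ResidueField.map_residue]
      exact hres c⟩
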